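/- Let $\mathcal S=\{(1,0),(-1,0),(-1,1),(1,-1)\}$ (steps E, W, NW, SE). For integers $i,j,n\ge 0$ let $q(i,j;n)$ be the number of $n$-step walks in $\mathbb Z^2$ with steps in $\mathcal S$ that start at $(0,0)$, end at $(i,j)$ and stay in the quarter plane $\{(a,b): a\ge 0,\ b\ge 0\}$. Let $$Q(x,y;t)=\sum_{i,j,n\ge 0} q(i,j;n)\,x^iy^jt^n\in\mathbb Q[[x,y,t]],\qquad Q(0,0;t)=\sum_{n\ge 0}q(0,0;n)\,t^n .$$ Write $\bar x=1/x$, $\bar y=1/y$. For a power series $F(x,y;t)=\sum_{n\ge0}\sum_{i,j\in\mathbb Z} f(i,j;n)x^iy^jt^n$ in $t$ with coefficients in $\mathbb Q[x,\bar x,y,\bar y]$, its non-negative part is $[x^\ge y^\ge]F(x,y;t)=\sum_{n,i,j\ge 0} f(i,j;n)x^iy^jt^n$. A power series $F\in\mathbb Q[[x_1,\dots,x_k]]$ is D-finite if the vector space over $\mathbb Q(x_1,\dots,x_k)$ spanned by all its iterated partial derivatives (including $F$ itself) has finite dimension; it is transcendental if it satisfies no non-trivial polynomial equation $P(x_1,\dots,x_k,F)=0$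 with coefficients in $\mathbb Q$. Binomial coefficients $\binom{N}{k}$ with $k<0$ or $k>N$ are $0$. Then the following hold. 1. $Q(x,y;t)=[x^\ge y^\ge]\tilde R(x,y;t)$, where $\tilde R$ is the expansion in powers of $t$ of the rational function $$\tilde R(x,y;t)=\frac{(1-\bar x)(1+\bar x)(1-\bar y)(1-\bar x^2y)(1-x\bar y)(1+x\bar y)}{1-t(x+\bar x+x\bar y+\bar xy)} .$$ 2. $Q(x,y;t)$ is D-finite (in the three variables $x,y,t$). 3. For all integers $i,j\ge 0$ and $m$ with $2m+i\ge 0$, $$q(i,j;2m+i)=\frac{(i+1)(j+1)(i+j+2)(i+2j+3)}{(2m+i+1)(2m+i+2)(2m+i+3)^2}\binom{2m+i+3}{m-j}\binom{2m+i+3}{m+1}.$$ 4. For all $m\ge 0$, $$q(0,0;2m)=\frac{6\,(2m)!\,(2m+2)!}{m!\,(m+1)!\,(m+2)!\,(m+3)!},\qquad\text{and}\qquad q(0,0;2m)\sim\frac{24\cdot 4^{2m}}{\pi m^5}\quad(m\to\infty).$$ 5. The series $Q(0,0;t)$ and $Q(x,y;t)$ are transcendental. -/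

import Mathlib

open scoped Nat Asymptotics

/-- The step set `{E, W, NW, SE}`. -/
def gbSteps : Finset (ℤ × ℤ) := {(1, 0), (-1, 0), (-1, 1), (1, -1)}

/-- The point reached after the first `k` steps of the walk which starts at the origin and
has successive steps `s 0, s 1, …`. -/
def walkPosition {S : Finset (ℤ × ℤ)} {n : ℕ} (s : Fin n → S) (k : ℕ) : ℤ × ℤ :=
  ∑ l : Fin n with l.val < k, (s l : ℤ × ℤ)

/-- The number `q(i, j; n)` of `n`-step walks with steps in `S` that start at `(0, 0)`, stay in
the quarter plane `{(a, b) : a ≥ 0, b ≥ 0}` and end at `(i, j)`. -/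
def quadrantWalks (S : Finset (ℤ × ℤ)) (i j n : ℕ) : ℕ :=
  Finset.card {s : Fin n → S |
    (∀ k ≤ n, 0 ≤ (walkPosition s k).1 ∧ 0 ≤ (walkPosition s k).2) ∧
      walkPosition s n = ((i : ℤ), (j : ℤ))}

/-- The generating function `Q(x, y; t) = ∑ q(i, j; n) x ^ i y ^ j t ^ n`, as a formal power
series over `ℚ` in the variables `x = X 0`, `y = X 1`, `t = X 2`. -/
def quadrantSeries (S : Finset (ℤ × ℤ)) : MvPowerSeries (Fin 3) ℚ :=
  fun d => (quadrantWalks S (d 0) (d 1) (d 2) : ℚ)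

/-- The specialization `F(0, 0; t)` of a series `F(x, y; t)`. -/
noncomputable def specializeZeroZero (F : MvPowerSeries (Fin 3) ℚ) : PowerSeries ℚ :=
  PowerSeries.mk fun n => MvPowerSeries.coeff (Finsupp.single 2 n) F

/-- The ring `ℚ[x, x⁻¹, y, y⁻¹]` of Laurent polynomials in `x` and `y`. -/
abbrev Laurent2 : Type := AddMonoidAlgebra ℚ (ℤ × ℤ)

/-- The Laurent monomial `x ^ a y ^ b`. -/
noncomputable def lmon (a b : ℤ) : Laurent2 := AddMonoidAlgebra.single (a, b) 1

/-- The non-negative part (in `x` and `y`) `[x^≥ y^≥] F(x, y; t)` of a power series in `t` with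
coefficients in `ℚ[x, x⁻¹, y, y⁻¹]`, seen as a formal power series in `x`, `y`, `t`. -/
noncomputable def nonnegPart (F : PowerSeries Laurent2) : MvPowerSeries (Fin 3) ℚ :=
  fun d => (PowerSeries.coeff (d 2) F).coeff ((d 0 : ℤ), (d 1 : ℤ))

/-- The numerator `(1 - x⁻¹)(1 + x⁻¹)(1 - y⁻¹)(1 - x⁻²y)(1 - xy⁻¹)(1 + xy⁻¹)`. -/
noncomputable def gbNumerator : Laurent2 :=
  (1 - lmon (-1) 0) * (1 + lmon (-1) 0) * (1 - lmon 0 (-1)) * (1 - lmon (-2) 1) *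
    (1 - lmon 1 (-1)) * (1 + lmon 1 (-1))

/-- The denominator `1 - t (x + x⁻¹ + xy⁻¹ + x⁻¹y)`, as a polynomial in `t`. -/
noncomputable def gbDenominator : PowerSeries Laurent2 :=
  1 - PowerSeries.X *
    PowerSeries.C (lmon 1 0 + lmon (-1) 0 + lmon 1 (-1) + lmon (-1) 1)

/-- The expansion in powers of `t` of the rational function `gbNumerator / gbDenominator`. -/
noncomputable def gbRational : PowerSeries Laurent2 :=
  PowerSeries.C gbNumerator * PowerSeries.invOfUnit gbDenominator 1

/-- `gbRational` is indeed the quotient of `gbNumerator` by `gbDenominator`. -/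
theorem gbRational_mul_gbDenominator :
    gbRational * gbDenominator = PowerSeries.C gbNumerator := by
  rw [gbRational, mul_assoc, PowerSeries.invOfUnit_mul, mul_one]
  simp [gbDenominator]

/-- The binomial coefficient, with the convention that it vanishes when `k < 0`. -/
def intChoose (n : ℕ) (k : ℤ) : ℕ := if 0 ≤ k then n.choose k.toNat else 0

instance faithfulSMul_fractionRing_mvPowerSeries (σ K : Type*) [Field K] :
    FaithfulSMul (MvPolynomial σ K) (FractionRing (MvPowerSeries σ K)) := by
  rw [faithfulSMul_iff_algebraMap_injective,
    IsScalarTower.algebraMap_eq (MvPolynomial σ K) (MvPowerSeries σ K)]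
  refine (IsFractionRing.injective (MvPowerSeries σ K) _).comp fun p q h => ?_
  simpa [MvPowerSeries.algebraMap_apply'] using h

/-- The power series obtained from `F` by applying successively the partial derivatives with
respect to the variables in the list `l`. -/
noncomputable def iterPDeriv {σ K : Type*} [Field K] (F : MvPowerSeries σ K) (l : List σ) :
    MvPowerSeries σ K :=
  l.foldr (fun i G => MvPowerSeries.pderiv K i G) F

/-- A power series `F ∈ K[[x₁, …, x_k]]` is D-finite if the vector space over `K(x₁, …, x_k)`
spanned by all its (iterated) partial derivatives, inside the fraction field of
`K[[x₁, …, x_k]]`, is finite-dimensional. -/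
def IsDFinite {σ K : Type*} [Finite σ] [Field K] (F : MvPowerSeries σ K) : Prop :=
  letI : Algebra (FractionRing (MvPolynomial σ K)) (FractionRing (MvPowerSeries σ K)) :=
    FractionRing.liftAlgebra (MvPolynomial σ K) (FractionRing (MvPowerSeries σ K))
  FiniteDimensional (FractionRing (MvPolynomial σ K))
    (Submodule.span (FractionRing (MvPolynomial σ K))
      (Set.range fun l : List σ =>
        algebraMap (MvPowerSeries σ K) (FractionRing (MvPowerSeries σ K)) (iterPDeriv F l)))

/-! Everything rests on one principle, `gbCount_unique`: the last-step recurrence, the initial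
values and vanishing on the lines `i = -1` and `j = -1` determine the numbers `q(i, j; n)`. Two
candidates pass this test.

The closed form (`gbClosed_succ`) satisfies the recurrence by a polynomial identity once all
reciprocal factorials are reduced to a common product, and its factors `i + 1` and `j + 1` vanish on
the two lines. The coefficients of the rational function (`gbCoeff`) satisfy the recurrence on all
of `ℤ²`. The eight monomials of the numerator form a signed orbit under the dihedral group of order
8 generated by two affine reflections whose linear parts permute the steps. Hence the coefficients
are antisymmetric, and they vanish on the lines `i = -1` and `j = -1`, which the reflections fix.

Asymptotics: the excursion numbers are `4 ^ (2 * m)` divided by the Wallis product, times an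
explicit rational function of `m`, and the Wallis product tends to `π / 2`.

Transcendence: algebraicity survives the Euler operator `t d/dt`. Four applications to `Q(0, 0; t)`
multiply the coefficients by `n ^ 4`, which makes them comparable to those of `-log (1 - 16 t²)`.
The resulting function tends to infinity at `t = 1/4`, but more slowly than any negative power of
the distance, which is impossible for an algebraic series (`not_isAlgebraic_of_logarithmic_growth`).
Specializing `x = y = 0` preserves algebraicity, so `Q(x, y; t)` is transcendental too.

D-finiteness is obtained from the closed form. The functional equation expresses `Q(x, y; t)`
rationally through `Q(x, 0; t)` and `Q(0, y; t)`. Each of these satisfies two independent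
first-order linear equations, with `Q(0, 0; t)` and its Euler derivative as inhomogeneous terms, and
`Q(0, 0; t)` satisfies a second-order equation. So five series (`gbSpanning`) span a space over
`ℚ(x, y, t)` that is stable under differentiation. -/

/-! ### The step-by-step recurrence for quadrant walks -/

/-- The number of `n`-step walks in the quarter plane with steps in `S` that end at `z`. -/
def quadrantCount (S : Finset (ℤ × ℤ)) (n : ℕ) (z : ℤ × ℤ) : ℕ :=
  Finset.card {s : Fin n → S |
    (∀ k ≤ n, 0 ≤ (walkPosition s k).1 ∧ 0 ≤ (walkPosition s k).2) ∧ walkPosition s n = z}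

lemma walkPosition_snoc_of_le {S : Finset (ℤ × ℤ)} {n : ℕ} (s : Fin n → S) (e : S) {k : ℕ}
    (hk : k ≤ n) :
    walkPosition (Fin.snoc (α := fun _ => (S : Type)) s e : Fin (n + 1) → S) k =
      walkPosition s k := by
  simp [walkPosition, Finset.sum_filter, Fin.sum_univ_castSucc, hk]

lemma walkPosition_snoc_last {S : Finset (ℤ × ℤ)} {n : ℕ} (s : Fin n → S) (e : S) :
    walkPosition (Fin.snoc (α := fun _ => (S : Type)) s e : Fin (n + 1) → S) (n + 1) =
      walkPosition s n + e := by
  simp [walkPosition, Finset.sum_filter, Fin.sum_univ_castSucc]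

lemma quadrantCount_zero (S : Finset (ℤ × ℤ)) (z : ℤ × ℤ) :
    quadrantCount S 0 z = if z = 0 then 1 else 0 := by
  simp only [quadrantCount, walkPosition, Finset.univ_eq_empty, Finset.filter_empty,
    Finset.sum_empty]
  split_ifs with h
  · simp [h]
  · simp [Ne.symm h]

lemma quadrantCount_of_not_nonneg (S : Finset (ℤ × ℤ)) (n : ℕ) (z : ℤ × ℤ)
    (h : ¬ (0 ≤ z.1 ∧ 0 ≤ z.2)) : quadrantCount S n z = 0 := by
  rw [quadrantCount, Finset.card_eq_zero, Finset.filter_eq_empty_iff]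
  rintro s - ⟨h1, rfl⟩
  exact h (h1 n le_rfl)

/-- Split off the last step with `Fin.snocEquiv`. The sign hypotheses on `z` supply the quadrant
condition at time `n + 1`, the only one not inherited from the shorter walk. -/
lemma quadrantCount_succ (S : Finset (ℤ × ℤ)) (n : ℕ) (z : ℤ × ℤ) (h1 : 0 ≤ z.1) (h2 : 0 ≤ z.2) :
    quadrantCount S (n + 1) z = ∑ e ∈ S, quadrantCount S n (z - e) := by
  classical
  rw [← Finset.sum_coe_sort S (fun e => quadrantCount S n (z - e))]
  simp only [quadrantCount, Finset.card_filter]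
  rw [← Fintype.sum_equiv (Fin.snocEquiv fun _ : Fin (n + 1) => (S : Type)) _ _ (fun _ => rfl),
    Fintype.sum_prod_type]
  refine Finset.sum_congr rfl fun e _ => Finset.sum_congr rfl fun s _ => ?_
  refine if_congr ?_ rfl rfl
  change ((∀ k ≤ n + 1, 0 ≤ (walkPosition (Fin.snoc (α := fun _ => (S : Type)) s e) k).1 ∧
    0 ≤ (walkPosition (Fin.snoc (α := fun _ => (S : Type)) s e) k).2) ∧
    walkPosition (Fin.snoc (α := fun _ => (S : Type)) s e) (n + 1) = z) ↔ _
  rw [walkPosition_snoc_last, eq_sub_iff_add_eq]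
  refine and_congr_left fun hz => ⟨fun h k hk => ?_, fun h k hk => ?_⟩
  · simpa only [walkPosition_snoc_of_le s e hk] using h k (by omega)
  · rcases Nat.lt_or_ge n k with hk' | hk'
    · obtain rfl : k = n + 1 := by omega
      rw [walkPosition_snoc_last, hz]
      exact ⟨h1, h2⟩
    · simpa only [walkPosition_snoc_of_le s e hk'] using h k hk'

/-- The number `q(i, j; n)` of walks with steps `E, W, NW, SE`, for arbitrary integers `i, j`. -/
def gbCount (n : ℕ) (i j : ℤ) : ℚ := quadrantCount gbSteps n (i, j)

lemma gbCount_natCast (n i j : ℕ) : gbCount n i j = quadrantWalks gbSteps i j n := rfl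

lemma gbCount_zero (i j : ℤ) : gbCount 0 i j = if i = 0 ∧ j = 0 then 1 else 0 := by
  simp [gbCount, quadrantCount_zero, Prod.ext_iff]

lemma gbCount_of_neg (n : ℕ) (i j : ℤ) (h : i < 0 ∨ j < 0) : gbCount n i j = 0 := by
  rw [gbCount, quadrantCount_of_not_nonneg, Nat.cast_zero]
  simp only
  omega

lemma gbCount_succ (n : ℕ) (i j : ℤ) (hi : 0 ≤ i) (hj : 0 ≤ j) :
    gbCount (n + 1) i j = gbCount n (i - 1) j + gbCount n (i + 1) j +
      gbCount n (i + 1) (j - 1) + gbCount n (i - 1) (j + 1) := by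
  rw [gbCount, quadrantCount_succ _ _ _ hi hj]
  simp [gbCount, gbSteps, add_assoc]

/-- A function on `ℕ × ℤ × ℤ` that satisfies the recurrence of the walk, vanishes on the lines
`i = -1` and `j = -1` and has the right initial values counts the walks. -/
lemma gbCount_unique (G : ℕ → ℤ → ℤ → ℚ)
    (h0 : ∀ i j, 0 ≤ i → 0 ≤ j → G 0 i j = if i = 0 ∧ j = 0 then 1 else 0)
    (hi : ∀ n j, G n (-1) j = 0) (hj : ∀ n i, G n i (-1) = 0)
    (hs : ∀ n i j, 0 ≤ i → 0 ≤ j → G (n + 1) i j = G n (i - 1) j + G n (i + 1) j +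
      G n (i + 1) (j - 1) + G n (i - 1) (j + 1))
    (n : ℕ) (i j : ℤ) (h1 : -1 ≤ i) (h2 : -1 ≤ j) : gbCount n i j = G n i j := by
  induction n generalizing i j with
  | zero =>
    rcases h1.eq_or_lt with rfl | h1
    · rw [hi, gbCount_of_neg]; simp
    rcases h2.eq_or_lt with rfl | h2
    · rw [hj, gbCount_of_neg]; simp
    rw [gbCount_zero, h0 _ _ (by omega) (by omega)]
  | succ n ih =>
    rcases h1.eq_or_lt with rfl | h1
    · rw [hi, gbCount_of_neg]; simp
    rcases h2.eq_or_lt with rfl | h2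
    · rw [hj, gbCount_of_neg]; simp
    -- The four neighbours of a quadrant point may lie on the lines `i = -1` or `j = -1`, but never
    -- beyond; this is why the induction covers `-1 ≤ i, j`.
    rw [gbCount_succ _ _ _ (by omega) (by omega), hs _ _ _ (by omega) (by omega),
      ih _ _ (by omega) (by omega), ih _ _ (by omega) (by omega), ih _ _ (by omega) (by omega),
      ih _ _ (by omega) (by omega)]

/-! ### The closed form -/

/-- The reciprocal factorial `1 / k!`, extended by `0` to negative integers. -/
def rfact (k : ℤ) : ℚ := if 0 ≤ k then 1 / (k.toNat ! : ℚ) else 0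

lemma rfact_natCast (k : ℕ) : rfact k = 1 / (k ! : ℚ) := by simp [rfact]

lemma rfact_of_neg {k : ℤ} (h : k < 0) : rfact k = 0 := by simp [rfact, h]

/-- The convention `1 / k! = 0` for negative `k` is what makes this hold at every integer, so later
identities need no boundary cases. -/
lemma rfact_sub_one (k : ℤ) : rfact (k - 1) = k * rfact k := by
  rcases lt_trichotomy k 0 with h | rfl | h
  · rw [rfact_of_neg h, rfact_of_neg (by omega), mul_zero]
  · rw [rfact_of_neg (by omega)]; simp
  · obtain ⟨l, rfl⟩ : ∃ l : ℕ, k = (l + 1 : ℕ) := ⟨(k - 1).toNat, by omega⟩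
    rw [show (((l + 1 : ℕ) : ℤ) - 1) = (l : ℕ) by push_cast; ring, rfact_natCast, rfact_natCast,
      Nat.factorial_succ]
    push_cast
    have : (l ! : ℚ) ≠ 0 := by positivity
    field_simp

lemma intChoose_eq (N : ℕ) (k : ℤ) : (intChoose N k : ℚ) = N ! * rfact k * rfact (N - k) := by
  rcases lt_or_ge k 0 with h | h
  · simp [intChoose, rfact_of_neg h, h]
  obtain ⟨l, rfl⟩ := Int.eq_ofNat_of_zero_le h
  rcases lt_or_ge N l with h' | h'
  · rw [rfact_of_neg (k := (N : ℤ) - l) (by omega)]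
    simp [intChoose, Nat.choose_eq_zero_of_lt h']
  · rw [← Nat.cast_sub h', rfact_natCast, rfact_natCast, intChoose, if_pos h, Int.toNat_natCast,
      Nat.cast_choose ℚ h']
    field_simp

/-- The closed form of `q(i, j; n)` for `n = 2 * m + i`. -/
def gbClosed (n : ℕ) (i j m : ℤ) : ℚ :=
  (i + 1) * (j + 1) * (i + j + 2) * (i + 2 * j + 3) * n ! * (n + 2)! *
    (rfact (m - j) * rfact (m + i + j + 3) * rfact (m + 1) * rfact (m + i + 2))

/-- Each of the four steps lowers exactly two of the four factorial arguments by one. After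
`rfact_sub_one` all terms share the same product of reciprocal factorials, and a polynomial identity
in `i, j, m` remains. -/
lemma gbClosed_succ (n : ℕ) (i j m : ℤ) (h : (n : ℤ) + 1 = 2 * m + i) :
    gbClosed (n + 1) i j m = gbClosed n (i - 1) j m + gbClosed n (i + 1) j (m - 1) +
      gbClosed n (i + 1) (j - 1) (m - 1) + gbClosed n (i - 1) (j + 1) m := by
  have e1 := rfact_sub_one (m - j)
  have e2 := rfact_sub_one (m + i + j + 3)
  have e3 := rfact_sub_one (m + 1)
  have e4 := rfact_sub_one (m + i + 2)
  simp only [gbClosed]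
  rw [show m + (i - 1) + j + 3 = m + i + j + 3 - 1 by ring,
    show m + (i - 1) + 2 = m + i + 2 - 1 by ring,
    show m - 1 - j = m - j - 1 by ring, show m - 1 + (i + 1) + j + 3 = m + i + j + 3 by ring,
    show m - 1 + 1 = m + 1 - 1 by ring, show m - 1 + (i + 1) + 2 = m + i + 2 by ring,
    show m - 1 - (j - 1) = m - j by ring,
    show m - 1 + (i + 1) + (j - 1) + 3 = m + i + j + 3 - 1 by ring,
    show m - (j + 1) = m - j - 1 by ring,
    show m + (i - 1) + (j + 1) + 3 = m + i + j + 3 by ring, e1, e2, e3, e4]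
  have hn : (n : ℚ) = 2 * m + i - 1 := by
    have : ((n : ℤ) : ℚ) = ((2 * m + i - 1 : ℤ) : ℚ) := by rw [← h]; simp
    push_cast at this; exact this
  rw [show n + 1 + 2 = (n + 2) + 1 by ring, Nat.factorial_succ, Nat.factorial_succ (n + 2)]
  push_cast
  rw [hn]
  ring

lemma gbClosed_zero (i j m : ℤ) (hi : 0 ≤ i) (hj : 0 ≤ j) (h : 0 = 2 * m + i) :
    gbClosed 0 i j m = if i = 0 ∧ j = 0 then 1 else 0 := by
  have hm : m ≤ 0 := by omega
  rcases hj.eq_or_lt with rfl | hj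
  · rcases hm.eq_or_lt with rfl | hm
    · obtain rfl : i = 0 := by omega
      simp [gbClosed, rfact, Nat.factorial]
      norm_num
    · simp [gbClosed, rfact_of_neg hm]
      omega
  · rw [gbClosed, rfact_of_neg (k := m - j) (by omega), if_neg (by omega)]
    simp

/-- `q(i, j; n)` in closed form, for `n ≡ i` modulo `2`, and extended by `0`. -/
def gbFormula (n : ℕ) (i j : ℤ) : ℚ :=
  if (n - i) % 2 = 0 then gbClosed n i j ((n - i) / 2) else 0

lemma gbFormula_even {n : ℕ} {i m : ℤ} (j : ℤ) (h : (n : ℤ) = 2 * m + i) :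
    gbFormula n i j = gbClosed n i j m := by
  rw [gbFormula, if_pos (by omega), show ((n : ℤ) - i) / 2 = m by omega]

lemma gbFormula_odd {n : ℕ} {i m : ℤ} (j : ℤ) (h : (n : ℤ) = 2 * m + i + 1) :
    gbFormula n i j = 0 := by
  rw [gbFormula, if_neg (by omega)]

lemma gbCount_eq_gbFormula (n : ℕ) (i j : ℤ) (hi : -1 ≤ i) (hj : -1 ≤ j) :
    gbCount n i j = gbFormula n i j := by
  refine gbCount_unique gbFormula (fun i j hi hj => ?_) (fun n j => ?_) (fun n i => ?_)
    (fun n i j _ _ => ?_) n i j hi hj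
  · obtain ⟨m, hm⟩ := Int.even_or_odd' ((0 : ℕ) - i)
    rcases hm with hm | hm
    · rw [gbFormula_even (m := m) j (by omega), gbClosed_zero _ _ _ hi hj (by omega)]
    · rw [gbFormula_odd (m := m) j (by omega), if_neg (by omega)]
  -- The factor `i + 1`, and in the next case `j + 1`, is zero.
  · simp [gbFormula, gbClosed]
  · simp [gbFormula, gbClosed]
  · obtain ⟨m, hm⟩ := Int.even_or_odd' ((n + 1 : ℕ) - i)
    rcases hm with hm | hm
    · rw [gbFormula_even (m := m) j (by omega), gbFormula_even (m := m) j (by push_cast at hm; omega),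
        gbFormula_even (m := m - 1) j (by push_cast at hm; omega),
        gbFormula_even (m := m - 1) (j - 1) (by push_cast at hm; omega),
        gbFormula_even (m := m) (j + 1) (by push_cast at hm; omega),
        gbClosed_succ _ _ _ _ (by push_cast at hm; omega)]
    · rw [gbFormula_odd (m := m) j (by omega), gbFormula_odd (m := m) j (by push_cast at hm; omega),
        gbFormula_odd (m := m - 1) j (by push_cast at hm; omega),
        gbFormula_odd (m := m - 1) (j - 1) (by push_cast at hm; omega),
        gbFormula_odd (m := m) (j + 1) (by push_cast at hm; omega)]
      simp

lemma gbCount_eq_gbClosed {n : ℕ} {i j m : ℤ} (hi : -1 ≤ i) (hj : -1 ≤ j)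
    (h : (n : ℤ) = 2 * m + i) : gbCount n i j = gbClosed n i j m := by
  rw [gbCount_eq_gbFormula _ _ _ hi hj, gbFormula_even _ h]

lemma gbCount_eq_zero_of_odd {n : ℕ} {i j m : ℤ}
    (h : (n : ℤ) = 2 * m + i + 1) : gbCount n i j = 0 := by
  by_cases hij : i < 0 ∨ j < 0
  · exact gbCount_of_neg _ _ _ hij
  · rw [gbCount_eq_gbFormula _ _ _ (by omega) (by omega), gbFormula_odd _ h]

theorem quadrantWalks_gbSteps_eq (i j n : ℕ) (m : ℤ) (h : (n : ℤ) = 2 * m + i) :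
    (quadrantWalks gbSteps i j n : ℚ) =
      ((i + 1) * (j + 1) * (i + j + 2) * (i + 2 * j + 3)) /
          ((2 * m + i + 1) * (2 * m + i + 2) * (2 * m + i + 3) ^ 2) *
        intChoose (n + 3) (m - j) * intChoose (n + 3) (m + 1) := by
  rw [← gbCount_natCast, gbCount_eq_gbClosed (by omega) (by omega) h, gbClosed, intChoose_eq,
    intChoose_eq]
  have hn : 2 * (m : ℚ) + i = n := by exact_mod_cast h.symm
  rw [hn, show ((n + 3 : ℕ) : ℤ) - (m - j) = m + i + j + 3 by push_cast; omega,
    show ((n + 3 : ℕ) : ℤ) - (m + 1) = m + i + 2 by push_cast; omega]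
  rw [show (n + 3)! = (n + 3) * (n + 2)! from rfl]
  have hf : ((n + 2)! : ℚ) = (n + 2) * ((n + 1) * n !) := by
    push_cast [Nat.factorial_succ]; ring
  push_cast
  rw [hf]
  have : (n : ℚ) + 1 ≠ 0 := by positivity
  have : (n : ℚ) + 2 ≠ 0 := by positivity
  have : (n : ℚ) + 3 ≠ 0 := by positivity
  field_simp

theorem quadrantWalks_gbSteps_origin (m : ℕ) :
    (quadrantWalks gbSteps 0 0 (2 * m) : ℚ) =
      (6 * (2 * m)! * (2 * m + 2)! : ℕ) / (m ! * (m + 1)! * (m + 2)! * (m + 3)! : ℕ) := by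
  rw [← gbCount_natCast, gbCount_eq_gbClosed (m := m) (by omega) (by omega) (by push_cast; ring),
    gbClosed]
  rw [show (m : ℤ) - (0 : ℕ) = (m : ℕ) by simp,
    show (m : ℤ) + (0 : ℕ) + (0 : ℕ) + 3 = (m + 3 : ℕ) by simp,
    show (m : ℤ) + 1 = (m + 1 : ℕ) by simp, show (m : ℤ) + (0 : ℕ) + 2 = (m + 2 : ℕ) by simp]
  simp only [rfact_natCast]
  push_cast
  field_simp
  ring

/-! ### The coefficients of the rational function -/

lemma lmon_mul_lmon (a b c d : ℤ) : lmon a b * lmon c d = lmon (a + c) (b + d) := by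
  simp [lmon, AddMonoidAlgebra.single_mul_single]

lemma lmon_zero : lmon 0 0 = 1 := rfl

lemma coeff_lmon_mul (a b : ℤ) (f : Laurent2) (z : ℤ × ℤ) :
    (lmon a b * f).coeff z = f.coeff (z.1 - a, z.2 - b) := by
  rw [lmon, AddMonoidAlgebra.coeff_single_mul_apply, one_mul]
  congr 1
  ext <;> simp <;> ring

/-- The coefficient of `x ^ i y ^ j t ^ n` in `gbRational`. -/
noncomputable def gbCoeff (n : ℕ) (i j : ℤ) : ℚ := (PowerSeries.coeff n gbRational).coeff (i, j)

lemma coeff_zero_gbRational : PowerSeries.coeff 0 gbRational = gbNumerator := by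
  have h := congrArg (PowerSeries.coeff 0) gbRational_mul_gbDenominator
  simpa [gbDenominator] using h

lemma coeff_succ_gbRational (n : ℕ) : PowerSeries.coeff (n + 1) gbRational =
    (lmon 1 0 + lmon (-1) 0 + lmon 1 (-1) + lmon (-1) 1) * PowerSeries.coeff n gbRational := by
  have h := congrArg (PowerSeries.coeff (n + 1)) gbRational_mul_gbDenominator
  rw [gbDenominator, mul_sub, mul_one, map_sub, ← mul_assoc, PowerSeries.coeff_mul_C,
    PowerSeries.coeff_succ_mul_X, PowerSeries.coeff_C, if_neg (Nat.succ_ne_zero n),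
    sub_eq_zero] at h
  rw [h, mul_comm]

lemma gbCoeff_succ (n : ℕ) (i j : ℤ) :
    gbCoeff (n + 1) i j = gbCoeff n (i - 1) j + gbCoeff n (i + 1) j +
      gbCoeff n (i + 1) (j - 1) + gbCoeff n (i - 1) (j + 1) := by
  simp only [gbCoeff, coeff_succ_gbRational, add_mul, AddMonoidAlgebra.coeff_add,
    Finsupp.add_apply, coeff_lmon_mul, sub_zero, sub_neg_eq_add]
  ring

/-- The exponents are the eight images of `(0, 0)` under the group generated by `(i, j) ↦ (-i - 2, i
+ j + 1)` and `(i, j) ↦ (i + 2j + 2, -j - 2)`, each with the sign of the group element. -/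
lemma gbNumerator_eq : gbNumerator =
    lmon 0 0 - lmon (-2) 1 - lmon 2 (-2) + lmon 2 (-3) + lmon (-4) 1 - lmon (-4) 0 -
      lmon 0 (-3) + lmon (-2) (-2) := by
  simp only [gbNumerator, mul_sub, mul_add, sub_mul, add_mul, mul_one, one_mul, lmon_mul_lmon]
  norm_num [lmon_zero]
  abel

lemma gbCoeff_zero (i j : ℤ) : gbCoeff 0 i j =
    (if i = 0 ∧ j = 0 then 1 else 0) - (if i = -2 ∧ j = 1 then 1 else 0) -
    (if i = 2 ∧ j = -2 then 1 else 0) + (if i = 2 ∧ j = -3 then 1 else 0) +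
    (if i = -4 ∧ j = 1 then 1 else 0) - (if i = -4 ∧ j = 0 then 1 else 0) -
    (if i = 0 ∧ j = -3 then 1 else 0) + (if i = -2 ∧ j = -2 then 1 else 0) := by
  simp [gbCoeff, coeff_zero_gbRational, gbNumerator_eq, lmon, Finsupp.single_apply,
    eq_comm (b := i), eq_comm (b := j)]

/-- The linear part `(a, b) ↦ (-a, a + b)` permutes the four steps, so the recurrence propagates the
antisymmetry of the numerator. The reflection fixes the line `i = -1` pointwise. -/
lemma gbCoeff_reflect_left (n : ℕ) (i j : ℤ) :
    gbCoeff n (-i - 2) (i + j + 1) = -gbCoeff n i j := by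
  induction n generalizing i j with
  | zero =>
    have h : ∀ c d : ℤ, (-i - 2 = c ∧ i + j + 1 = d) ↔ (i = -c - 2 ∧ j = c + d + 1) := by omega
    simp only [gbCoeff_zero, h]
    norm_num
    ring
  | succ n ih =>
    have h1 := ih (i - 1) j
    have h2 := ih (i + 1) j
    have h3 := ih (i + 1) (j - 1)
    have h4 := ih (i - 1) (j + 1)
    rw [gbCoeff_succ, gbCoeff_succ]
    ring_nf at h1 h2 h3 h4 ⊢
    linarith

/-- Same argument with the linear part `(a, b) ↦ (a + 2b, -b)`, which swaps NW and SE and fixes E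
and W; here the fixed line is `j = -1`. -/
lemma gbCoeff_reflect_right (n : ℕ) (i j : ℤ) :
    gbCoeff n (i + 2 * j + 2) (-j - 2) = -gbCoeff n i j := by
  induction n generalizing i j with
  | zero =>
    have h : ∀ c d : ℤ, (i + 2 * j + 2 = c ∧ -j - 2 = d) ↔ (i = c + 2 * d + 2 ∧ j = -d - 2) := by
      omega
    simp only [gbCoeff_zero, h]
    norm_num
    ring
  | succ n ih =>
    have h1 := ih (i - 1) j
    have h2 := ih (i + 1) j
    have h3 := ih (i + 1) (j - 1)
    have h4 := ih (i - 1) (j + 1)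
    rw [gbCoeff_succ, gbCoeff_succ]
    ring_nf at h1 h2 h3 h4 ⊢
    linarith

lemma gbCount_eq_gbCoeff (n : ℕ) (i j : ℤ) (hi : -1 ≤ i) (hj : -1 ≤ j) :
    gbCount n i j = gbCoeff n i j := by
  refine gbCount_unique gbCoeff (fun i j hi hj => ?_) (fun n j => ?_) (fun n i => ?_)
    (fun n i j _ _ => gbCoeff_succ n i j) n i j hi hj
  -- Of the eight points of the orbit only the origin lies in the quadrant.
  · rw [gbCoeff_zero, if_neg (c := i = -2 ∧ j = 1) (by omega),
      if_neg (c := i = 2 ∧ j = -2) (by omega), if_neg (c := i = 2 ∧ j = -3) (by omega),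
      if_neg (c := i = -4 ∧ j = 1) (by omega), if_neg (c := i = -4 ∧ j = 0) (by omega),
      if_neg (c := i = 0 ∧ j = -3) (by omega), if_neg (c := i = -2 ∧ j = -2) (by omega)]
    ring
  · have h := gbCoeff_reflect_left n (-1) j
    norm_num at h
    linarith
  · have h := gbCoeff_reflect_right n i (-1)
    norm_num at h
    linarith

theorem quadrantSeries_gbSteps_eq_nonnegPart :
    quadrantSeries gbSteps = nonnegPart gbRational := by
  funext d
  change (quadrantWalks gbSteps (d 0) (d 1) (d 2) : ℚ) = gbCoeff (d 2) (d 0) (d 1)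
  rw [← gbCount_eq_gbCoeff _ _ _ (by omega) (by omega), gbCount_natCast]

/-! ### Asymptotics of the number of excursions -/

/-- The Wallis product contains `(2m)! ^ 2 / m! ^ 4`, the only non-rational factor of the closed
form. This gives both the asymptotics and uniform bounds without Stirling's formula. -/
lemma quadrantWalks_origin_eq_wallis (m : ℕ) :
    (quadrantWalks gbSteps 0 0 (2 * m) : ℝ) =
      4 ^ (2 * m) / Real.Wallis.W m *
        (12 / (((m : ℝ) + 1) * (m + 1) * (m + 2) * (m + 2) * (m + 3))) := by
  have h := congrArg (Rat.cast (K := ℝ)) (quadrantWalks_gbSteps_origin m)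
  rw [Rat.cast_natCast] at h
  rw [h, Real.Wallis.W_eq_factorial_ratio]
  rw [show (2 * m + 2)! = (2 * m + 2) * ((2 * m + 1) * (2 * m)!) from rfl,
    show (m + 1)! = (m + 1) * m ! from rfl, show (m + 2)! = (m + 2) * ((m + 1) * m !) from rfl,
    show (m + 3)! = (m + 3) * ((m + 2) * ((m + 1) * m !)) from rfl,
    show (2 : ℝ) ^ (4 * m) = 4 ^ (2 * m) by
      rw [show (4 : ℝ) = 2 ^ 2 by norm_num, ← pow_mul]; congr 1; ring]
  push_cast
  have h1 : (m ! : ℝ) ≠ 0 := by positivity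
  have h2 : ((2 * m)! : ℝ) ≠ 0 := by positivity
  field_simp
  ring

open Filter Topology in
theorem quadrantWalks_origin_isEquivalent :
    (fun m : ℕ => (quadrantWalks gbSteps 0 0 (2 * m) : ℝ)) ~[atTop]
      (fun m : ℕ => 24 * 4 ^ (2 * m) / (Real.pi * (m : ℝ) ^ 5)) := by
  rw [Asymptotics.isEquivalent_iff_tendsto_one]
  · have hW := (tendsto_const_nhds (x := Real.pi / 2)).div Real.Wallis.tendsto_W_nhds_pi_div_two
      (by positivity)
    have h1 := tendsto_natCast_div_add_atTop (𝕜 := ℝ) (1 : ℝ)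
    have h2 := tendsto_natCast_div_add_atTop (𝕜 := ℝ) (2 : ℝ)
    have h3 := tendsto_natCast_div_add_atTop (𝕜 := ℝ) (3 : ℝ)
    have h := hW.mul ((((h1.mul h1).mul h2).mul h2).mul h3)
    rw [div_self (by positivity)] at h
    simp only [mul_one] at h
    refine h.congr' ?_
    filter_upwards [eventually_gt_atTop 0] with m hm
    have hm' : (m : ℝ) ≠ 0 := by positivity
    have hW0 : Real.Wallis.W m ≠ 0 := (Real.Wallis.W_pos m).ne'
    simp only [Pi.div_apply, quadrantWalks_origin_eq_wallis]
    field_simp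
    ring
  · filter_upwards [eventually_gt_atTop 0] with m hm
    positivity

/-! ### Algebraic elements and derivations -/

/-- A derivation which sends the base ring to algebraic elements preserves algebraicity, in
characteristic zero. -/
theorem IsAlgebraic.derivation {R A B : Type*} [CommRing R] [CommRing A] [IsDomain A] [CharZero A]
    [CommRing B] [IsDomain B] [Algebra R B] [Algebra A B] [FaithfulSMul A B] (d : Derivation R B B)
    (hd : ∀ a : A, IsAlgebraic A (d (algebraMap A B a))) {f : B} (hf : IsAlgebraic A f) :
    IsAlgebraic A (d f) := by
  classical
  -- The difference is `p` with `d` applied to its coefficients, evaluated at `f`, hence algebraic.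
  have key : ∀ p : Polynomial A,
      IsAlgebraic A (d (Polynomial.aeval f p) - Polynomial.aeval f p.derivative * d f) := by
    intro p
    induction p using Polynomial.induction_on' with
    | add p q hp hq =>
      convert hp.add hq using 1
      simp only [map_add, add_mul]
      ring
    | monomial n a =>
      convert (hf.pow n).mul (hd a) using 1
      simp only [Polynomial.aeval_monomial, Derivation.leibniz, Derivation.leibniz_pow,
        Polynomial.derivative_monomial, smul_eq_mul, nsmul_eq_mul, map_mul, map_natCast]
      ring
  have hex : ∃ n, ∃ p : Polynomial A, p.natDegree = n ∧ p ≠ 0 ∧ Polynomial.aeval f p = 0 := by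
    obtain ⟨p, h1, h2⟩ := hf
    exact ⟨_, p, rfl, h1, h2⟩
  -- By minimality of the degree, and characteristic zero, `p'(f) ≠ 0`; as `p(f) = 0`, `key` then
  -- shows that `p'(f) * d f` is algebraic, and `p'(f)` can be cancelled.
  obtain ⟨p, hdeg, hp0, hp⟩ := Nat.find_spec hex
  have hpos : p.natDegree ≠ 0 := by
    intro h0
    rw [Polynomial.eq_C_of_natDegree_eq_zero h0, Polynomial.aeval_C,
      map_eq_zero_iff _ (FaithfulSMul.algebraMap_injective A B)] at hp
    exact hp0 (by rw [Polynomial.eq_C_of_natDegree_eq_zero h0, hp, map_zero])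
  have hne : Polynomial.aeval f p.derivative ≠ 0 := by
    intro h
    have hlt := Polynomial.natDegree_derivative_lt hpos
    rw [hdeg] at hlt
    refine Nat.find_min hex hlt ⟨_, rfl, fun h' => hpos ?_, h⟩
    exact Polynomial.derivative_eq_zero.mp h'
  have h1 := (key p).neg
  rw [hp, map_zero, zero_sub, neg_neg] at h1
  refine IsAlgebraic.of_mul (mem_nonZeroDivisors_of_ne_zero hne) ?_ h1
  exact Algebra.isAlgebraic_adjoin_singleton_iff.mpr hf _ (Polynomial.aeval_mem_adjoin_singleton _ _)

/-- An algebraic element is a root of a polynomial whose coefficients are not all divisible by a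
given non-unit. -/
theorem IsAlgebraic.exists_not_dvd_coeff {A B : Type*} [CommRing A] [IsDomain A]
    [IsNoetherianRing A] [CommRing B] [IsDomain B] [Algebra A B] [FaithfulSMul A B] {f : B}
    (hf : IsAlgebraic A f) {π : A} (hπ0 : π ≠ 0) (hπ : ¬ IsUnit π) :
    ∃ p : Polynomial A, Polynomial.aeval f p = 0 ∧ ∃ k, ¬ π ∣ p.coeff k := by
  obtain ⟨p, hp0, hp⟩ := hf
  obtain ⟨n, q, hq, rfl⟩ := WfDvdMonoid.max_power_factor' hp0 (x := Polynomial.C π)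
    (by rwa [Polynomial.isUnit_C])
  refine ⟨q, ?_, ?_⟩
  · rw [map_mul, map_pow, Polynomial.aeval_C, mul_eq_zero] at hp
    refine hp.resolve_left (pow_ne_zero _ ?_)
    rwa [Ne, map_eq_zero_iff _ (FaithfulSMul.algebraMap_injective A B)]
  · by_contra! h
    exact hq (Polynomial.C_dvd_iff_dvd_coeff _ _ |>.mpr h)

/-- Algebraicity is preserved by specialization at a principal ideal. -/
theorem IsAlgebraic.specialize {A B A' B' : Type*} [CommRing A] [IsDomain A]
    [IsNoetherianRing A] [CommRing B] [IsDomain B] [Algebra A B] [FaithfulSMul A B]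
    [CommRing A'] [CommRing B'] [Algebra A' B'] {f : B} (hf : IsAlgebraic A f)
    {π : A} (hπ0 : π ≠ 0) (hπ : ¬ IsUnit π) (g : A →+* A') (G : B →+* B')
    (hgG : ∀ a, G (algebraMap A B a) = algebraMap A' B' (g a)) (hg : ∀ a, g a = 0 → π ∣ a) :
    IsAlgebraic A' (G f) := by
  -- With the powers of `π` divided out, the annihilating polynomial cannot vanish after
  -- specialization.
  obtain ⟨p, hp, k, hk⟩ := hf.exists_not_dvd_coeff hπ0 hπ
  refine ⟨p.map g, fun h => hk (hg _ ?_), ?_⟩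
  · rw [← Polynomial.coeff_map, h, Polynomial.coeff_zero]
  · rw [Polynomial.aeval_def, Polynomial.eval₂_map, show (algebraMap A' B').comp g = G.comp (algebraMap A B) from
      RingHom.ext fun a => (hgG a).symm, ← Polynomial.hom_eval₂, ← Polynomial.aeval_def, hp, map_zero]

instance PowerSeries.faithfulSMul_polynomial (K : Type*) [Field K] :
    FaithfulSMul (Polynomial K) (PowerSeries K) := by
  rw [faithfulSMul_iff_algebraMap_injective]
  exact fun p q h => Polynomial.coe_injective K (by simpa [PowerSeries.algebraMap_apply'] using h)

/-! ### Evaluation of power series at real numbers -/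

/-- The power series `F` converges absolutely at `t`, with sum `v`. -/
def PowerSeries.EvalsTo (F : PowerSeries ℚ) (t v : ℝ) : Prop :=
  Summable (fun n => ‖((PowerSeries.coeff n F : ℚ) : ℝ) * t ^ n‖) ∧
    HasSum (fun n => ((PowerSeries.coeff n F : ℚ) : ℝ) * t ^ n) v

namespace PowerSeries.EvalsTo

variable {F G : PowerSeries ℚ} {t v w : ℝ}

lemma add (hF : F.EvalsTo t v) (hG : G.EvalsTo t w) : (F + G).EvalsTo t (v + w) := by
  have h : ∀ n, ((PowerSeries.coeff n (F + G) : ℚ) : ℝ) * t ^ n =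
      ((PowerSeries.coeff n F : ℚ) : ℝ) * t ^ n + ((PowerSeries.coeff n G : ℚ) : ℝ) * t ^ n := by
    intro n; rw [map_add]; push_cast; ring
  simp only [EvalsTo, h]
  exact ⟨.of_nonneg_of_le (fun _ => norm_nonneg _) (fun _ => norm_add_le _ _) (hF.1.add hG.1),
    hF.2.add hG.2⟩

lemma mul (hF : F.EvalsTo t v) (hG : G.EvalsTo t w) : (F * G).EvalsTo t (v * w) := by
  have h : ∀ n, ((PowerSeries.coeff n (F * G) : ℚ) : ℝ) * t ^ n =
      ∑ kl ∈ Finset.HasAntidiagonal.antidiagonal n, (((PowerSeries.coeff kl.1 F : ℚ) : ℝ) * t ^ kl.1) *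
        (((PowerSeries.coeff kl.2 G : ℚ) : ℝ) * t ^ kl.2) := by
    intro n
    rw [PowerSeries.coeff_mul]
    push_cast
    rw [Finset.sum_mul]
    refine Finset.sum_congr rfl fun kl hkl => ?_
    rw [← Finset.HasAntidiagonal.mem_antidiagonal.mp hkl, pow_add]
    ring
  simp only [EvalsTo, h]
  have hs := summable_norm_sum_mul_antidiagonal_of_summable_norm hF.1 hG.1
  refine ⟨hs, ?_⟩
  have := tsum_mul_tsum_eq_tsum_sum_antidiagonal_of_summable_norm hF.1 hG.1
  rw [hF.2.tsum_eq, hG.2.tsum_eq] at this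
  rw [this]
  exact hs.of_norm.hasSum

lemma polynomial (p : Polynomial ℚ) (t : ℝ) :
    (p : PowerSeries ℚ).EvalsTo t (Polynomial.aeval t p) := by
  have h : ∀ n ∉ p.support, ((PowerSeries.coeff n (p : PowerSeries ℚ) : ℚ) : ℝ) * t ^ n = 0 := by
    intro n hn
    rw [Polynomial.coeff_coe, Polynomial.notMem_support_iff.mp hn]
    simp
  refine ⟨summable_of_ne_finset_zero (s := p.support) fun n hn => by rw [h n hn, norm_zero], ?_⟩
  have hs : Polynomial.aeval t p =
      ∑ n ∈ p.support, ((PowerSeries.coeff n (p : PowerSeries ℚ) : ℚ) : ℝ) * t ^ n := by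
    simp [Polynomial.aeval_def, Polynomial.eval₂_eq_sum, Polynomial.sum_def]
  rw [hs]
  exact hasSum_sum_of_ne_finset_zero h

lemma pow (hF : F.EvalsTo t v) (n : ℕ) : (F ^ n).EvalsTo t (v ^ n) := by
  induction n with
  | zero => simpa using polynomial 1 t
  | succ n ih => rw [pow_succ, pow_succ]; exact ih.mul hF

lemma aeval (hF : F.EvalsTo t v) (P : Polynomial (Polynomial ℚ)) :
    (Polynomial.aeval F P).EvalsTo t
      (P.eval₂ (Polynomial.aeval t : Polynomial ℚ →ₐ[ℚ] ℝ).toRingHom v) := by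
  induction P using Polynomial.induction_on' with
  | add p q hp hq => simpa only [map_add, Polynomial.eval₂_add] using hp.add hq
  | monomial n a =>
    rw [Polynomial.aeval_monomial, Polynomial.eval₂_monomial]
    exact (polynomial a t).mul (hF.pow n)

lemma eq_zero_of_zero (h : EvalsTo 0 t v) : v = 0 := by
  have h' := h.2
  simp only [map_zero, Rat.cast_zero, zero_mul] at h'
  exact h'.unique hasSum_zero

end PowerSeries.EvalsTo

open Filter Topology in
/-- An algebraic power series cannot grow logarithmically at a rational point: if it tends to
infinity there, then not slower than every power of the distance. -/
theorem not_isAlgebraic_of_logarithmic_growth {F : PowerSeries ℚ} {r : ℚ} {h : ℝ → ℝ}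
    (hF : ∀ᶠ t in 𝓝[<] (r : ℝ), F.EvalsTo t (h t)) (h1 : Tendsto h (𝓝[<] (r : ℝ)) atTop)
    (h2 : ∀ j : ℕ, Tendsto (fun t => (t - r) * h t ^ j) (𝓝[<] (r : ℝ)) (𝓝 0)) :
    ¬ IsAlgebraic (Polynomial ℚ) F := by
  classical
  intro halg
  obtain ⟨P, hP, hk⟩ := halg.exists_not_dvd_coeff (Polynomial.X_sub_C_ne_zero r)
    (Polynomial.not_isUnit_X_sub_C r)
  have hdeg : ∀ k, ¬ (Polynomial.X - Polynomial.C r) ∣ P.coeff k → k ≤ P.natDegree := by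
    intro k hk
    by_contra! hlt
    exact hk (by rw [Polynomial.coeff_eq_zero_of_natDegree_lt hlt]; exact dvd_zero _)
  obtain ⟨k0, hk0⟩ := hk
  -- Divide `P(t, h) = 0` by `h ^ K`. Terms below `K` vanish in the limit because `h → ∞`; terms
  -- above carry a factor `t - r`, which beats every power of `h`. What survives is `P_K(r) = 0`,
  -- against the choice of `K`.
  set K := Nat.findGreatest (fun k => ¬ (Polynomial.X - Polynomial.C r) ∣ P.coeff k) P.natDegree
    with hK
  have hKs : ¬ (Polynomial.X - Polynomial.C r) ∣ P.coeff K :=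
    Nat.findGreatest_spec (P := fun k => ¬ (Polynomial.X - Polynomial.C r) ∣ P.coeff k)
      (hdeg _ hk0) hk0
  have hcont : ∀ p : Polynomial ℚ, Tendsto (fun t : ℝ => Polynomial.aeval t p) (𝓝[<] (r : ℝ))
      (𝓝 (Polynomial.aeval (r : ℝ) p)) := fun p =>
    (p.continuous_aeval (A := ℝ)).continuousAt.tendsto.mono_left nhdsWithin_le_nhds
  have hne : ∀ᶠ t in 𝓝[<] (r : ℝ), h t ≠ 0 := h1.eventually_ne_atTop 0
  have hlim : Tendsto (fun t => ∑ k ∈ Finset.range (P.natDegree + 1),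
      Polynomial.aeval t (P.coeff k) * h t ^ k / h t ^ K) (𝓝[<] (r : ℝ))
      (𝓝 (∑ k ∈ Finset.range (P.natDegree + 1),
        if k = K then Polynomial.aeval (r : ℝ) (P.coeff K) else 0)) := by
    refine tendsto_finsetSum _ fun k hk => ?_
    rcases lt_trichotomy k K with hlt | rfl | hgt
    · rw [if_neg hlt.ne]
      have h3 : Tendsto (fun t => (h t ^ (K - k))⁻¹) (𝓝[<] (r : ℝ)) (𝓝 0) :=
        ((tendsto_pow_atTop (by omega)).comp h1).inv_tendsto_atTop
      have h4 := (hcont (P.coeff k)).mul h3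
      rw [mul_zero] at h4
      refine h4.congr' ?_
      filter_upwards [hne] with t ht
      rw [mul_div_assoc]
      congr 1
      rw [eq_div_iff (pow_ne_zero _ ht), ← Nat.sub_add_cancel hlt.le, pow_add,
        Nat.add_sub_cancel, inv_mul_cancel_left₀ (pow_ne_zero _ ht)]
    · rw [if_pos rfl]
      refine (hcont _).congr' ?_
      filter_upwards [hne] with t ht
      rw [mul_div_cancel_right₀ _ (pow_ne_zero _ ht)]
    · rw [if_neg hgt.ne']
      have hd : (Polynomial.X - Polynomial.C r) ∣ P.coeff k := by
        by_contra hd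
        exact Nat.findGreatest_is_greatest hgt (hdeg k hd) hd
      obtain ⟨q, hq⟩ := hd
      have h4 := (hcont q).mul (h2 (k - K))
      rw [mul_zero] at h4
      refine h4.congr' ?_
      filter_upwards [hne] with t ht
      rw [eq_div_iff (pow_ne_zero _ ht), hq, ← Nat.sub_add_cancel hgt.le, pow_add,
        Nat.add_sub_cancel]
      simp
      ring
  rw [Finset.sum_ite_eq' , if_pos (Finset.mem_range.mpr (Nat.lt_succ_of_le (hdeg _ hKs)))] at hlim
  have hzero : ∀ᶠ t in 𝓝[<] (r : ℝ), ∑ k ∈ Finset.range (P.natDegree + 1),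
      Polynomial.aeval t (P.coeff k) * h t ^ k / h t ^ K = 0 := by
    filter_upwards [hF] with t ht
    have h5 := ht.aeval P
    rw [hP] at h5
    have h6 := h5.eq_zero_of_zero
    rw [Polynomial.eval₂_eq_sum_range] at h6
    rw [← Finset.sum_div, div_eq_zero_iff]
    exact Or.inl h6
  have h7 := tendsto_nhds_unique (hlim.congr' hzero) tendsto_const_nhds
  apply hKs
  rw [Polynomial.dvd_iff_isRoot, Polynomial.IsRoot]
  have h8 : Polynomial.aeval (r : ℝ) (P.coeff K) = (((P.coeff K).eval r : ℚ) : ℝ) := by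
    simpa using Polynomial.aeval_algebraMap_apply ℝ r (P.coeff K)
  rw [h8] at h7
  exact_mod_cast h7

/-! ### Transcendence of the generating function of excursions -/

/-- The Euler operator `X d/dX` preserves algebraicity. -/
lemma IsAlgebraic.X_mul_derivative {f : PowerSeries ℚ} (hf : IsAlgebraic (Polynomial ℚ) f) :
    IsAlgebraic (Polynomial ℚ) (PowerSeries.X * PowerSeries.derivative ℚ f) := by
  have hX : IsAlgebraic (Polynomial ℚ) (PowerSeries.X : PowerSeries ℚ) := by
    rw [← Polynomial.coe_X]
    exact isAlgebraic_algebraMap (A := PowerSeries ℚ) (Polynomial.X : Polynomial ℚ)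
  refine hX.mul (IsAlgebraic.derivation (PowerSeries.derivative ℚ) (fun a => ?_) hf)
  change IsAlgebraic _ (PowerSeries.derivative ℚ (a : PowerSeries ℚ))
  rw [PowerSeries.derivative_coe]
  exact isAlgebraic_algebraMap (A := PowerSeries ℚ) (Polynomial.derivative a)

lemma coeff_X_mul_derivative (f : PowerSeries ℚ) (n : ℕ) :
    PowerSeries.coeff n (PowerSeries.X * PowerSeries.derivative ℚ f) =
      n * PowerSeries.coeff n f := by
  cases n with
  | zero => simp
  | succ n => 
    rw [PowerSeries.coeff_succ_X_mul, PowerSeries.coeff_derivative]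
    push_cast
    ring

lemma wallis_bounds (m : ℕ) : 1 / 2 ≤ Real.Wallis.W m ∧ Real.Wallis.W m ≤ 2 := by
  have h1 := Real.Wallis.le_W m
  have h2 := Real.Wallis.W_le m
  have h3 := Real.pi_gt_three
  have h4 := Real.pi_le_four
  refine ⟨le_trans ?_ h1, by linarith⟩
  have h5 : (1 : ℝ) / 2 ≤ (2 * (m : ℝ) + 1) / (2 * m + 2) := by
    rw [div_le_div_iff₀ (by norm_num) (by positivity)]
    have : (0 : ℝ) ≤ m := by positivity
    linarith
  nlinarith

/-- The number of excursions decreases like `4 ^ (2 * m) / m ^ 5`. -/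
lemma quadrantWalks_origin_bounds (m : ℕ) :
    (1 / 24 : ℝ) * (4 ^ (2 * (m + 1)) / (m + 1)) ≤
        ((2 * (m + 1) : ℕ) : ℝ) ^ 4 * quadrantWalks gbSteps 0 0 (2 * (m + 1)) ∧
      ((2 * (m + 1) : ℕ) : ℝ) ^ 4 * quadrantWalks gbSteps 0 0 (2 * (m + 1)) ≤
        384 * (4 ^ (2 * (m + 1)) / (m + 1)) := by
  obtain ⟨h1, h2⟩ := wallis_bounds (m + 1)
  have hW : 0 < Real.Wallis.W (m + 1) := by linarith
  have hm : (0 : ℝ) ≤ m := by positivity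
  set x : ℝ := (m : ℝ) + 1 with hx
  have hx1 : 1 ≤ x := by linarith
  set p : ℝ := 4 ^ (2 * (m + 1))
  have hp : 0 < p := by positivity
  -- Here `192 = 2 ^ 4 * 12`. The index `m + 1` omits the empty walk and matches the terms `u ^ (m +
  -- 1) / (m + 1)` of the logarithm.
  have key : ((2 * (m + 1) : ℕ) : ℝ) ^ 4 * quadrantWalks gbSteps 0 0 (2 * (m + 1)) =
      (p / x) * (192 / Real.Wallis.W (m + 1)) *
        (x / (x + 1) * (x / (x + 1)) * (x / (x + 2)) * (x / (x + 2)) * (x / (x + 3))) := by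
    rw [quadrantWalks_origin_eq_wallis]
    push_cast
    rw [← hx]
    field_simp
    ring
  have b1 : 1 / 2 ≤ x / (x + 1) ∧ x / (x + 1) ≤ 1 := by
    constructor
    · rw [div_le_div_iff₀ (by norm_num) (by positivity)]; linarith
    · rw [div_le_one (by positivity)]; linarith
  have b2 : 1 / 3 ≤ x / (x + 2) ∧ x / (x + 2) ≤ 1 := by
    constructor
    · rw [div_le_div_iff₀ (by norm_num) (by positivity)]; linarith
    · rw [div_le_one (by positivity)]; linarith
  have b3 : 1 / 4 ≤ x / (x + 3) ∧ x / (x + 3) ≤ 1 := by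
    constructor
    · rw [div_le_div_iff₀ (by norm_num) (by positivity)]; linarith
    · rw [div_le_one (by positivity)]; linarith
  have b4 : 96 ≤ 192 / Real.Wallis.W (m + 1) ∧ 192 / Real.Wallis.W (m + 1) ≤ 384 := by
    constructor
    · rw [le_div_iff₀ hW]; linarith
    · rw [div_le_iff₀ hW]; linarith
  have hpx : 0 < p / x := by positivity
  rw [key]
  clear key
  generalize x / (x + 1) = a at *
  generalize x / (x + 2) = b at *
  generalize x / (x + 3) = c at *
  have ha : 0 ≤ a := by linarith
  have hb : 0 ≤ b := by linarith
  have hc : 0 ≤ c := by linarith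
  constructor
  · calc (1 / 24 : ℝ) * (p / x) ≤ (p / x) * 96 *
          (1 / 2 * (1 / 2) * (1 / 3) * (1 / 3) * (1 / 4)) := by linarith
      _ ≤ _ := by gcongr <;> tauto
  · calc _ ≤ (p / x) * 384 * (1 * 1 * 1 * 1 * 1) := by gcongr <;> tauto
      _ = _ := by ring

open Filter Topology in
lemma tendsto_neg_log :
    Tendsto (fun t : ℝ => -Real.log (1 - (4 * t) ^ 2)) (𝓝[<] (1 / 4)) atTop := by
  have h : Tendsto (fun t : ℝ => 1 - (4 * t) ^ 2) (𝓝[<] (1 / 4)) (𝓝[>] 0) := by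
    refine tendsto_nhdsWithin_iff.mpr ⟨?_, ?_⟩
    · have : ContinuousAt (fun t : ℝ => 1 - (4 * t) ^ 2) (1 / 4) := by fun_prop
      have h2 := this.tendsto.mono_left (nhdsWithin_le_nhds (s := Set.Iio (1 / 4 : ℝ)))
      norm_num at h2 ⊢
      exact h2
    · filter_upwards [Ioo_mem_nhdsLT (show (0 : ℝ) < 1 / 4 by norm_num)] with t ht
      simp only [Set.mem_Ioi]
      nlinarith [ht.1, ht.2]
  exact tendsto_neg_atBot_atTop.comp (Real.tendsto_log_nhdsGT_zero.comp h)

-- With `u = -log (1 - 16 t²)`, the bound `1/4 - t ≤ (1 - 4t)(1 + 4t) = exp (-u)` reduces the claim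
-- to `u ^ j * exp (-u) → 0`.
open Filter Topology in
lemma tendsto_sub_mul_log_pow (j : ℕ) :
    Tendsto (fun t : ℝ => (1 / 4 - t) * (-Real.log (1 - (4 * t) ^ 2)) ^ j) (𝓝[<] (1 / 4))
      (𝓝 0) := by
  have h := (Real.tendsto_pow_mul_exp_neg_atTop_nhds_zero j).comp tendsto_neg_log
  have hev := Ioo_mem_nhdsLT (show (0 : ℝ) < 1 / 4 by norm_num)
  refine squeeze_zero' ?_ ?_ h
  · filter_upwards [hev] with t ht
    have hlog : 0 ≤ -Real.log (1 - (4 * t) ^ 2) := by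
      rw [neg_nonneg]
      exact Real.log_nonpos (by nlinarith [ht.1, ht.2]) (by nlinarith [ht.1, ht.2])
    exact mul_nonneg (by linarith [ht.2]) (pow_nonneg hlog j)
  · filter_upwards [hev] with t ht
    have h0 : 0 < 1 - (4 * t) ^ 2 := by nlinarith [ht.1, ht.2]
    have hlog : 0 ≤ -Real.log (1 - (4 * t) ^ 2) := by
      rw [neg_nonneg]
      exact Real.log_nonpos h0.le (by nlinarith [ht.1, ht.2])
    simp only [Function.comp, neg_neg, Real.exp_log h0]
    rw [mul_comm]
    exact mul_le_mul_of_nonneg_left (by nlinarith [ht.1, ht.2]) (pow_nonneg hlog j)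

-- Excursions number about `4 ^ n / n ^ 5`, so four Euler operators leave coefficients of order `4 ^
-- n / n` on even `n`. For `0 < t < 1/4` the sum is therefore trapped between two multiples of `-log
-- (1 - 16 t²)`.
open Filter Topology in
theorem transcendental_specializeZeroZero :
    Transcendental (Polynomial ℚ) (specializeZeroZero (quadrantSeries gbSteps)) := by
  intro halg
  set f := specializeZeroZero (quadrantSeries gbSteps) with hf
  have hcoeff : ∀ n, PowerSeries.coeff n f = quadrantWalks gbSteps 0 0 n := by
    intro n
    rw [hf, specializeZeroZero, PowerSeries.coeff_mk]
    change ((quadrantWalks gbSteps (Finsupp.single 2 n 0) (Finsupp.single 2 n 1)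
      (Finsupp.single 2 n 2) : ℕ) : ℚ) = _
    simp
  have h4 := halg.X_mul_derivative.X_mul_derivative.X_mul_derivative.X_mul_derivative
  set F := PowerSeries.X * PowerSeries.derivative ℚ (PowerSeries.X * PowerSeries.derivative ℚ
    (PowerSeries.X * PowerSeries.derivative ℚ (PowerSeries.X * PowerSeries.derivative ℚ f)))
    with hF
  have hFc : ∀ n, ((PowerSeries.coeff n F : ℚ) : ℝ) = (n : ℝ) ^ 4 * quadrantWalks gbSteps 0 0 n := by
    intro n
    rw [hF]
    simp only [coeff_X_mul_derivative, hcoeff]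
    push_cast
    ring
  -- termwise comparison with the logarithm
  have hmain : ∀ t ∈ Set.Ioo (0 : ℝ) (1 / 4), ∃ v, F.EvalsTo t v ∧
      1 / 24 * (-Real.log (1 - (4 * t) ^ 2)) ≤ v ∧ v ≤ 384 * (-Real.log (1 - (4 * t) ^ 2)) := by
    intro t ht
    have hlog := Real.hasSum_pow_div_log_of_abs_lt_one (x := (4 * t) ^ 2) (by
      rw [abs_of_nonneg (by positivity)]
      nlinarith [ht.1, ht.2])
    have hinj : Function.Injective fun m : ℕ => 2 * (m + 1) := fun a b h => by
      simp only at h; omega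
    have hsupp : ∀ n ∉ Set.range (fun m : ℕ => 2 * (m + 1)),
        ((PowerSeries.coeff n F : ℚ) : ℝ) * t ^ n = 0 := by
      intro n hn
      rw [hFc]
      rcases Nat.even_or_odd' n with ⟨k, rfl | rfl⟩
      · cases k with
        | zero => simp
        | succ k => exact absurd ⟨k, rfl⟩ hn
      · have := gbCount_eq_zero_of_odd (n := 2 * k + 1) (i := 0) (j := 0) (m := k) (by push_cast; ring)
        have h0 : (quadrantWalks gbSteps 0 0 (2 * k + 1) : ℚ) = 0 := this
        rw [Nat.cast_eq_zero.mp h0]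
        simp
    have hb : ∀ m : ℕ, 1 / 24 * (((4 * t) ^ 2) ^ (m + 1) / (m + 1)) ≤
        ((PowerSeries.coeff (2 * (m + 1)) F : ℚ) : ℝ) * t ^ (2 * (m + 1)) ∧
        ((PowerSeries.coeff (2 * (m + 1)) F : ℚ) : ℝ) * t ^ (2 * (m + 1)) ≤
        384 * (((4 * t) ^ 2) ^ (m + 1) / (m + 1)) := by
      intro m
      obtain ⟨h1, h2⟩ := quadrantWalks_origin_bounds m
      have hpt : (0 : ℝ) ≤ t ^ (2 * (m + 1)) := by have := ht.1; positivity
      rw [hFc, ← pow_mul, mul_pow]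
      have e : ∀ c p q x : ℝ, c * (p * q / x) = c * (p / x) * q := by intros; ring
      rw [e, e]
      exact ⟨mul_le_mul_of_nonneg_right h1 hpt, mul_le_mul_of_nonneg_right h2 hpt⟩
    have hnn : ∀ m : ℕ, 0 ≤ ((PowerSeries.coeff (2 * (m + 1)) F : ℚ) : ℝ) * t ^ (2 * (m + 1)) :=
      fun m => le_trans (by positivity) (hb m).1
    have hs : Summable fun m : ℕ =>
        ((PowerSeries.coeff (2 * (m + 1)) F : ℚ) : ℝ) * t ^ (2 * (m + 1)) :=
      .of_nonneg_of_le hnn (fun m => (hb m).2) (hlog.summable.mul_left 384)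
    refine ⟨_, ⟨?_, (hinj.hasSum_iff hsupp).mp hs.hasSum⟩, ?_, ?_⟩
    · rw [← hinj.summable_iff fun n hn => by rw [hsupp n hn, norm_zero]]
      exact hs.norm
    · exact hasSum_le (fun m => (hb m).1) (hlog.mul_left _) hs.hasSum
    · exact hasSum_le (fun m => (hb m).2) hs.hasSum (hlog.mul_left _)
  choose! h hh using hmain
  have hev : ∀ᶠ t in 𝓝[<] (((1 / 4 : ℚ) : ℝ)), t ∈ Set.Ioo (0 : ℝ) (1 / 4) := by
    have := Ioo_mem_nhdsLT (show (0 : ℝ) < 1 / 4 by norm_num)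
    push_cast
    exact this
  refine not_isAlgebraic_of_logarithmic_growth (r := 1 / 4) (h := h) ?_ ?_ ?_ h4
  · filter_upwards [hev] with t ht using (hh t ht).1
  · have := tendsto_neg_log.const_mul_atTop (show (0 : ℝ) < 1 / 24 by norm_num)
    refine tendsto_atTop_mono' _ ?_ (by push_cast; exact this)
    filter_upwards [hev] with t ht using (hh t ht).2.1
  · intro j
    have := (tendsto_sub_mul_log_pow j).const_mul (384 ^ j)
    rw [mul_zero] at this
    refine squeeze_zero_norm' ?_ (by push_cast; exact this)
    filter_upwards [hev] with t ht
    obtain ⟨-, h1, h2⟩ := hh t ht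
    have hlog : 0 ≤ -Real.log (1 - (4 * t) ^ 2) := by
      rw [neg_nonneg]
      exact Real.log_nonpos (by nlinarith [ht.1, ht.2]) (by nlinarith [ht.1, ht.2])
    have hpos : 0 ≤ h t := le_trans (by positivity) h1
    rw [norm_mul, norm_pow, Real.norm_of_nonneg hpos, Real.norm_eq_abs, abs_sub_comm,
      abs_of_nonneg (by push_cast; linarith [ht.2])]
    calc _ ≤ (((1 / 4 : ℚ) : ℝ) - t) * (384 * (-Real.log (1 - (4 * t) ^ 2))) ^ j := by
          have : 0 ≤ (((1 / 4 : ℚ) : ℝ) - t) := by push_cast; linarith [ht.2]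
          gcongr
      _ = _ := by rw [mul_pow]; push_cast; ring

/-! ### Transcendence of the full generating function -/

instance MvPowerSeries.faithfulSMul_mvPolynomial (σ K : Type*) [Field K] :
    FaithfulSMul (MvPolynomial σ K) (MvPowerSeries σ K) := by
  rw [faithfulSMul_iff_algebraMap_injective]
  exact fun p q h => by simpa [MvPowerSeries.algebraMap_apply'] using h

instance MvPowerSeries.isDomain (σ K : Type*) [Field K] : IsDomain (MvPowerSeries σ K) :=
  NoZeroDivisors.to_isDomain _

/-- Setting one variable to zero preserves algebraicity. -/
theorem MvPowerSeries.isAlgebraic_killCompl {σ τ K A : Type*} [Finite τ] [Field K]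
    [CommRing A] [Algebra A (MvPowerSeries σ K)] (e : σ ↪ τ) (i : τ) (hi : ∀ j, j ∈ Set.range e ↔ j ≠ i)
    (g : MvPolynomial τ K →+* A)
    (hg : ∀ a : MvPolynomial τ K, MvPowerSeries.killCompl e (a : MvPowerSeries τ K) =
      algebraMap A (MvPowerSeries σ K) (g a))
    {F : MvPowerSeries τ K} (hF : IsAlgebraic (MvPolynomial τ K) F) :
    IsAlgebraic A (MvPowerSeries.killCompl e F) := by
  refine hF.specialize (π := MvPolynomial.X i) (MvPolynomial.X_ne_zero i) ?_ g
    (MvPowerSeries.killCompl (R := K) e : MvPowerSeries τ K →+* MvPowerSeries σ K) ?_ ?_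
  · intro hu
    simpa using hu.map (MvPolynomial.eval (0 : τ → K))
  · intro a
    rw [MvPowerSeries.algebraMap_apply']
    simpa using hg a
  · intro a ha
    rw [MvPolynomial.X_dvd_iff_modMonomial_eq_zero]
    -- A coefficient of `a` whose exponent at `i` is zero survives in `killCompl e a`, so it
    -- vanishes; all remaining monomials are divisible by `X i`.
    ext d
    by_cases hd : d i = 0
    · rw [MvPolynomial.coeff_modMonomial_of_not_le _ (by
        simp [Finsupp.single_le_iff, hd])]
      have hr : d ∈ Set.range (Finsupp.embDomain (M := ℕ) e) := by
        rw [Finsupp.mem_range_embDomain_iff]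
        intro j hj
        rw [hi]
        rintro rfl
        exact (Finsupp.mem_support_iff.mp hj) hd
      obtain ⟨d, rfl⟩ := hr
      rw [← MvPolynomial.coeff_coe, ← MvPowerSeries.coeff_killCompl, hg, ha]
      simp
    · rw [MvPolynomial.coeff_modMonomial_of_le]
      · simp
      · rw [Finsupp.single_le_iff]; omega

lemma killCompl_killCompl_eq_specializeZeroZero (F : MvPowerSeries (Fin 3) ℚ) :
    MvPowerSeries.killCompl (⟨fun _ : Unit => (1 : Fin 2), fun _ _ _ => rfl⟩ : Unit ↪ Fin 2)
      (MvPowerSeries.killCompl (Fin.succEmb 2) F) = specializeZeroZero F := by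
  refine PowerSeries.ext fun n => ?_
  rw [specializeZeroZero, PowerSeries.coeff_mk, PowerSeries.coeff,
    MvPowerSeries.coeff_killCompl, MvPowerSeries.coeff_killCompl, Finsupp.embDomain_single,
    Finsupp.embDomain_single]
  rfl

/-- The variables are set to zero one at a time, since `IsAlgebraic.specialize` works modulo a
principal ideal: first `x`, then `y`, which has index `0` once `x` is gone. -/
theorem transcendental_of_specializeZeroZero {F : MvPowerSeries (Fin 3) ℚ}
    (hF : Transcendental (Polynomial ℚ) (specializeZeroZero F)) :
    Transcendental (MvPolynomial (Fin 3) ℚ) F := by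
  intro h
  refine hF ?_
  rw [← killCompl_killCompl_eq_specializeZeroZero]
  have h1 := MvPowerSeries.isAlgebraic_killCompl (Fin.succEmb 2) 0 (by decide)
    (MvPolynomial.aeval ![0, MvPolynomial.X 0, MvPolynomial.X 1] :
      MvPolynomial (Fin 3) ℚ →ₐ[ℚ] MvPolynomial (Fin 2) ℚ).toRingHom (fun a => ?_) h
  · refine MvPowerSeries.isAlgebraic_killCompl (A := Polynomial ℚ)
      (⟨fun _ : Unit => (1 : Fin 2), fun _ _ _ => rfl⟩ : Unit ↪ Fin 2) 0 (by simp; decide)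
      (MvPolynomial.aeval ![0, Polynomial.X] : MvPolynomial (Fin 2) ℚ →ₐ[ℚ] Polynomial ℚ).toRingHom
      (fun a => ?_) h1
    have := DFunLike.congr_fun (show (MvPowerSeries.killCompl (R := ℚ)
        (⟨fun _ : Unit => (1 : Fin 2), fun _ _ _ => rfl⟩ : Unit ↪ Fin 2)).comp
          (MvPolynomial.coeToMvPowerSeries.algHom ℚ) =
        ((Polynomial.coeToPowerSeries.algHom ℚ).comp
          (MvPolynomial.aeval ![0, Polynomial.X])) from ?_) a
    · exact this
    · ext i : 1
      fin_cases i
      · simpa using MvPowerSeries.killCompl_X_eq_zero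
          (e := (⟨fun _ : Unit => (1 : Fin 2), fun _ _ _ => rfl⟩ : Unit ↪ Fin 2))
          (by rintro ⟨u, hu⟩; cases hu)
      · simp
        exact MvPowerSeries.killCompl_X (R := ℚ)
          (e := (⟨fun _ : Unit => (1 : Fin 2), fun _ _ _ => rfl⟩ : Unit ↪ Fin 2)) ()
  · have := DFunLike.congr_fun (show (MvPowerSeries.killCompl (R := ℚ) (Fin.succEmb 2)).comp
          (MvPolynomial.coeToMvPowerSeries.algHom ℚ) =
        (MvPolynomial.coeToMvPowerSeries.algHom ℚ).comp
          (MvPolynomial.aeval ![0, MvPolynomial.X 0, MvPolynomial.X 1]) from ?_) a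
    · rw [MvPowerSeries.algebraMap_apply']
      simpa using this
    · ext i : 1
      fin_cases i
      · simpa using MvPowerSeries.killCompl_X_eq_zero (e := Fin.succEmb 2) (by simp)
      · simpa using MvPowerSeries.killCompl_X (e := Fin.succEmb 2) 0
      · simpa using MvPowerSeries.killCompl_X (e := Fin.succEmb 2) 1

/-! ### A criterion for D-finiteness -/

section DFinite

variable {σ K : Type*} [Field K]

/-- The power series which are linear combinations of elements of `S` with coefficients in the
field of rational functions. -/
noncomputable def ratSpan (S : Set (MvPowerSeries σ K)) :
    Submodule (MvPolynomial σ K) (MvPowerSeries σ K) where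
  carrier := {G | ∃ p : MvPolynomial σ K, p ≠ 0 ∧ p • G ∈ Submodule.span (MvPolynomial σ K) S}
  zero_mem' := ⟨1, one_ne_zero, by simp⟩
  add_mem' := by
    rintro G H ⟨p, hp, hG⟩ ⟨q, hq, hH⟩
    refine ⟨p * q, mul_ne_zero hp hq, ?_⟩
    rw [smul_add]
    refine add_mem ?_ ?_
    · rw [mul_comm, mul_smul]
      exact Submodule.smul_mem _ _ hG
    · rw [mul_smul]
      exact Submodule.smul_mem _ _ hH
  smul_mem' := by
    rintro r G ⟨p, hp, hG⟩
    refine ⟨p, hp, ?_⟩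
    rw [smul_comm]
    exact Submodule.smul_mem _ _ hG

lemma subset_ratSpan {S : Set (MvPowerSeries σ K)} {G : MvPowerSeries σ K} (h : G ∈ S) :
    G ∈ ratSpan S :=
  ⟨1, one_ne_zero, by rw [one_smul]; exact Submodule.subset_span h⟩

lemma mem_ratSpan_of_smul_mem {S : Set (MvPowerSeries σ K)} {G : MvPowerSeries σ K}
    {p : MvPolynomial σ K} (hp : p ≠ 0) (h : p • G ∈ ratSpan S) : G ∈ ratSpan S := by
  obtain ⟨q, hq, h⟩ := h
  exact ⟨q * p, mul_ne_zero hq hp, by rwa [mul_smul]⟩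

lemma MvPowerSeries.polynomial_smul (p : MvPolynomial σ K) (G : MvPowerSeries σ K) :
    p • G = (p : MvPowerSeries σ K) * G := by
  rw [Algebra.smul_def, MvPowerSeries.algebraMap_apply', Algebra.algebraMap_self,
    MvPowerSeries.map_id, RingHom.id_apply]

lemma MvPowerSeries.pderiv_polynomial_smul (i : σ) (p : MvPolynomial σ K)
    (G : MvPowerSeries σ K) :
    MvPowerSeries.pderiv K i (p • G) =
      p • MvPowerSeries.pderiv K i G + MvPolynomial.pderiv i p • G := by
  rw [MvPowerSeries.polynomial_smul, MvPowerSeries.polynomial_smul,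
    MvPowerSeries.polynomial_smul, Derivation.leibniz, MvPowerSeries.pderiv_coe, smul_eq_mul,
    smul_eq_mul, mul_comm G]

/-- If `p • G` is in the polynomial span, then `p • ∂G = ∂(p • G) - ∂p • G`, and `p` can be divided
out. -/
lemma pderiv_mem_ratSpan {S : Set (MvPowerSeries σ K)} {i : σ}
    (hS : ∀ G ∈ S, MvPowerSeries.pderiv K i G ∈ ratSpan S) {G : MvPowerSeries σ K}
    (hG : G ∈ ratSpan S) : MvPowerSeries.pderiv K i G ∈ ratSpan S := by
  have key : ∀ H ∈ Submodule.span (MvPolynomial σ K) S,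
      H ∈ ratSpan S ∧ MvPowerSeries.pderiv K i H ∈ ratSpan S := by
    intro H hH
    induction hH using Submodule.span_induction with
    | mem x hx => exact ⟨subset_ratSpan hx, hS x hx⟩
    | zero => simp
    | add x y _ _ hx hy =>
      rw [map_add]
      exact ⟨add_mem hx.1 hy.1, add_mem hx.2 hy.2⟩
    | smul a x _ hx =>
      rw [MvPowerSeries.pderiv_polynomial_smul]
      exact ⟨Submodule.smul_mem _ _ hx.1,
        add_mem (Submodule.smul_mem _ _ hx.2) (Submodule.smul_mem _ _ hx.1)⟩
  obtain ⟨p, hp, h⟩ := id hG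
  have h1 := (key _ h).2
  rw [MvPowerSeries.pderiv_polynomial_smul] at h1
  refine mem_ratSpan_of_smul_mem hp ?_
  have h2 := sub_mem h1 (Submodule.smul_mem _ (MvPolynomial.pderiv i p) hG)
  rwa [add_sub_cancel_right] at h2

lemma iterPDeriv_mem_ratSpan {S : Set (MvPowerSeries σ K)}
    (hS : ∀ G ∈ S, ∀ i, MvPowerSeries.pderiv K i G ∈ ratSpan S) {F : MvPowerSeries σ K}
    (hF : F ∈ ratSpan S) (l : List σ) : iterPDeriv F l ∈ ratSpan S := by
  induction l with
  | nil => exact hF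
  | cons i l ih => exact pderiv_mem_ratSpan (fun G hG => hS G hG i) ih

/-- A power series is D-finite if it is a combination, with rational coefficients, of finitely
many series whose first derivatives are again such combinations. -/
theorem isDFinite_of_mem_ratSpan [Finite σ] {S : Set (MvPowerSeries σ K)} (hfin : S.Finite)
    (hS : ∀ G ∈ S, ∀ i, MvPowerSeries.pderiv K i G ∈ ratSpan S) {F : MvPowerSeries σ K}
    (hF : F ∈ ratSpan S) : IsDFinite F := by
  unfold IsDFinite
  let _ : Algebra (FractionRing (MvPolynomial σ K)) (FractionRing (MvPowerSeries σ K)) :=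
    FractionRing.liftAlgebra (MvPolynomial σ K) (FractionRing (MvPowerSeries σ K))
  set L := FractionRing (MvPowerSeries σ K)
  set V : Submodule (FractionRing (MvPolynomial σ K)) L :=
    Submodule.span _ (algebraMap (MvPowerSeries σ K) L '' S) with hV
  have : FiniteDimensional (FractionRing (MvPolynomial σ K)) V :=
    FiniteDimensional.span_of_finite _ (hfin.image _)
  have key : ∀ G ∈ ratSpan S, algebraMap (MvPowerSeries σ K) L G ∈ V := by
    rintro G ⟨p, hp, hG⟩
    have h1 : ∀ H ∈ Submodule.span (MvPolynomial σ K) S, algebraMap (MvPowerSeries σ K) L H ∈ V := by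
      intro H hH
      induction hH using Submodule.span_induction with
      | mem x hx => exact Submodule.subset_span ⟨x, hx, rfl⟩
      | zero => simp
      | add x y _ _ hx hy => rw [map_add]; exact add_mem hx hy
      | smul a x _ hx =>
        rw [Algebra.smul_def, map_mul, ← IsScalarTower.algebraMap_apply,
          IsScalarTower.algebraMap_apply _ (FractionRing (MvPolynomial σ K)), ← Algebra.smul_def]
        exact Submodule.smul_mem _ _ hx
    have h2 := h1 _ hG
    rw [Algebra.smul_def, map_mul, ← IsScalarTower.algebraMap_apply,
      IsScalarTower.algebraMap_apply _ (FractionRing (MvPolynomial σ K)), ← Algebra.smul_def] at h2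
    have hp' : algebraMap (MvPolynomial σ K) (FractionRing (MvPolynomial σ K)) p ≠ 0 := by
      simpa using hp
    have h3 := Submodule.smul_mem V (algebraMap _ (FractionRing (MvPolynomial σ K)) p)⁻¹ h2
    rwa [smul_smul, inv_mul_cancel₀ hp', one_smul] at h3
  refine Submodule.finiteDimensional_of_le (S₂ := V) ?_
  rw [Submodule.span_le]
  rintro _ ⟨l, rfl⟩
  exact key _ (iterPDeriv_mem_ratSpan hS hF l)

end DFinite

/-! ### Coefficients of trivariate series at integer exponents -/

/-- The coefficient of `x ^ i y ^ j t ^ n`, for arbitrary integers `i, j, n`. -/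
noncomputable def extCoeff (F : MvPowerSeries (Fin 3) ℚ) (i j n : ℤ) : ℚ :=
  if 0 ≤ i ∧ 0 ≤ j ∧ 0 ≤ n then
    MvPowerSeries.coeff (Finsupp.equivFunOnFinite.symm ![i.toNat, j.toNat, n.toNat]) F else 0

lemma extCoeff_natCast (F : MvPowerSeries (Fin 3) ℚ) (d : Fin 3 →₀ ℕ) :
    extCoeff F (d 0) (d 1) (d 2) = MvPowerSeries.coeff d F := by
  rw [extCoeff, if_pos (by omega)]
  congr 2
  ext k
  fin_cases k <;> simp

lemma extCoeff_of_neg (F : MvPowerSeries (Fin 3) ℚ) {i j n : ℤ} (h : i < 0 ∨ j < 0 ∨ n < 0) :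
    extCoeff F i j n = 0 := by
  rw [extCoeff, if_neg (by omega)]

lemma exists_extCoeff_eq (i j n : ℤ) : (i < 0 ∨ j < 0 ∨ n < 0) ∨
    ∃ d : Fin 3 →₀ ℕ, i = d 0 ∧ j = d 1 ∧ n = d 2 := by
  by_cases h : i < 0 ∨ j < 0 ∨ n < 0
  · exact Or.inl h
  · refine Or.inr ⟨Finsupp.equivFunOnFinite.symm ![i.toNat, j.toNat, n.toNat], ?_⟩
    simp
    omega

lemma ext_of_extCoeff {F G : MvPowerSeries (Fin 3) ℚ}
    (h : ∀ i j n : ℤ, 0 ≤ i → 0 ≤ j → 0 ≤ n → extCoeff F i j n = extCoeff G i j n) : F = G := by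
  ext d
  rw [← extCoeff_natCast, ← extCoeff_natCast]
  exact h _ _ _ (by omega) (by omega) (by omega)

lemma extCoeff_add (F G : MvPowerSeries (Fin 3) ℚ) (i j n : ℤ) :
    extCoeff (F + G) i j n = extCoeff F i j n + extCoeff G i j n := by
  simp only [extCoeff]
  split_ifs <;> simp

lemma extCoeff_sub (F G : MvPowerSeries (Fin 3) ℚ) (i j n : ℤ) :
    extCoeff (F - G) i j n = extCoeff F i j n - extCoeff G i j n := by
  simp only [extCoeff]
  split_ifs <;> simp

lemma extCoeff_C_smul (c : ℚ) (F : MvPowerSeries (Fin 3) ℚ) (i j n : ℤ) :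
    extCoeff ((MvPolynomial.C c : MvPolynomial (Fin 3) ℚ) • F) i j n = c * extCoeff F i j n := by
  simp only [extCoeff, MvPowerSeries.polynomial_smul]
  split_ifs <;> simp

lemma coeff_X_smul (s : Fin 3) (F : MvPowerSeries (Fin 3) ℚ) (d : Fin 3 →₀ ℕ) :
    MvPowerSeries.coeff d ((MvPolynomial.X s : MvPolynomial (Fin 3) ℚ) • F) =
      if 1 ≤ d s then MvPowerSeries.coeff (d - Finsupp.single s 1) F else 0 := by
  rw [MvPowerSeries.polynomial_smul, MvPolynomial.coe_X, MvPowerSeries.X, MvPowerSeries.coeff_monomial_mul]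
  simp [Finsupp.single_le_iff]

lemma extCoeff_X0_smul (F : MvPowerSeries (Fin 3) ℚ) (i j n : ℤ) :
    extCoeff ((MvPolynomial.X 0 : MvPolynomial (Fin 3) ℚ) • F) i j n = extCoeff F (i - 1) j n := by
  rcases exists_extCoeff_eq i j n with h | ⟨d, rfl, rfl, rfl⟩
  · rw [extCoeff_of_neg _ h, extCoeff_of_neg _ (by omega)]
  · rw [extCoeff_natCast, coeff_X_smul]
    split_ifs with h
    · rw [← extCoeff_natCast]
      congr 1 <;> simp [h]
    · rw [extCoeff_of_neg _ (by omega)]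

lemma extCoeff_X1_smul (F : MvPowerSeries (Fin 3) ℚ) (i j n : ℤ) :
    extCoeff ((MvPolynomial.X 1 : MvPolynomial (Fin 3) ℚ) • F) i j n = extCoeff F i (j - 1) n := by
  rcases exists_extCoeff_eq i j n with h | ⟨d, rfl, rfl, rfl⟩
  · rw [extCoeff_of_neg _ h, extCoeff_of_neg _ (by omega)]
  · rw [extCoeff_natCast, coeff_X_smul]
    split_ifs with h
    · rw [← extCoeff_natCast]
      congr 1 <;> simp [h]
    · rw [extCoeff_of_neg _ (by omega)]

lemma extCoeff_X2_smul (F : MvPowerSeries (Fin 3) ℚ) (i j n : ℤ) :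
    extCoeff ((MvPolynomial.X 2 : MvPolynomial (Fin 3) ℚ) • F) i j n = extCoeff F i j (n - 1) := by
  rcases exists_extCoeff_eq i j n with h | ⟨d, rfl, rfl, rfl⟩
  · rw [extCoeff_of_neg _ h, extCoeff_of_neg _ (by omega)]
  · rw [extCoeff_natCast, coeff_X_smul]
    split_ifs with h
    · rw [← extCoeff_natCast]
      congr 1 <;> simp [h]
    · rw [extCoeff_of_neg _ (by omega)]

/-- The monomial `c x ^ a y ^ b t ^ e`. -/
noncomputable def tmon (c : ℚ) (a b e : ℕ) : MvPolynomial (Fin 3) ℚ :=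
  MvPolynomial.C c * (MvPolynomial.X 0 ^ a * (MvPolynomial.X 1 ^ b * MvPolynomial.X 2 ^ e))

/-- Since coefficients at negative exponents are zero, monomials act as pure shifts. Together with
the Euler operators, which act diagonally, this turns a differential equation into a recurrence for
the coefficients. -/
lemma extCoeff_tmon_smul (c : ℚ) (a b e : ℕ) (F : MvPowerSeries (Fin 3) ℚ) (i j n : ℤ) :
    extCoeff (tmon c a b e • F) i j n = c * extCoeff F (i - a) (j - b) (n - e) := by
  have h0 : ∀ (a : ℕ) (F : MvPowerSeries (Fin 3) ℚ) (i j n : ℤ),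
      extCoeff ((MvPolynomial.X 0 ^ a : MvPolynomial (Fin 3) ℚ) • F) i j n =
        extCoeff F (i - a) j n := by
    intro a
    induction a with
    | zero => simp
    | succ a ih =>
      intro F i j n
      rw [pow_succ, mul_smul, ih, extCoeff_X0_smul]
      congr 1; push_cast; ring
  have h1 : ∀ (a : ℕ) (F : MvPowerSeries (Fin 3) ℚ) (i j n : ℤ),
      extCoeff ((MvPolynomial.X 1 ^ a : MvPolynomial (Fin 3) ℚ) • F) i j n =
        extCoeff F i (j - a) n := by
    intro a
    induction a with
    | zero => simp
    | succ a ih =>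
      intro F i j n
      rw [pow_succ, mul_smul, ih, extCoeff_X1_smul]
      congr 1; push_cast; ring
  have h2 : ∀ (a : ℕ) (F : MvPowerSeries (Fin 3) ℚ) (i j n : ℤ),
      extCoeff ((MvPolynomial.X 2 ^ a : MvPolynomial (Fin 3) ℚ) • F) i j n =
        extCoeff F i j (n - a) := by
    intro a
    induction a with
    | zero => simp
    | succ a ih =>
      intro F i j n
      rw [pow_succ, mul_smul, ih, extCoeff_X2_smul]
      congr 1; push_cast; ring
  rw [tmon, mul_smul, mul_smul, mul_smul, extCoeff_C_smul, h0, h1, h2]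

lemma eval_tmon (c : ℚ) (a b e : ℕ) (v : Fin 3 → ℚ) :
    MvPolynomial.eval v (tmon c a b e) = c * (v 0 ^ a * (v 1 ^ b * v 2 ^ e)) := by
  simp [tmon]

/-- The Euler operator `x_s ∂ / ∂ x_s`. -/
noncomputable def euler (s : Fin 3) (F : MvPowerSeries (Fin 3) ℚ) : MvPowerSeries (Fin 3) ℚ :=
  (MvPolynomial.X s : MvPolynomial (Fin 3) ℚ) • MvPowerSeries.pderiv ℚ s F

lemma coeff_euler (s : Fin 3) (F : MvPowerSeries (Fin 3) ℚ) (d : Fin 3 →₀ ℕ) :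
    MvPowerSeries.coeff d (euler s F) = d s * MvPowerSeries.coeff d F := by
  rw [euler, coeff_X_smul]
  split_ifs with h
  · have hd : d - Finsupp.single s 1 + Finsupp.single s 1 = d :=
      tsub_add_cancel_of_le (by simpa [Finsupp.single_le_iff] using h)
    rw [MvPowerSeries.coeff_pderiv, hd, mul_comm]
    congr 1
    simp [h]
  · simp [show d s = 0 by omega]

lemma extCoeff_euler0 (F : MvPowerSeries (Fin 3) ℚ) (i j n : ℤ) :
    extCoeff (euler 0 F) i j n = i * extCoeff F i j n := by
  rcases exists_extCoeff_eq i j n with h | ⟨d, rfl, rfl, rfl⟩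
  · rw [extCoeff_of_neg _ h, extCoeff_of_neg _ h, mul_zero]
  · rw [extCoeff_natCast, extCoeff_natCast, coeff_euler, Int.cast_natCast]

lemma extCoeff_euler1 (F : MvPowerSeries (Fin 3) ℚ) (i j n : ℤ) :
    extCoeff (euler 1 F) i j n = j * extCoeff F i j n := by
  rcases exists_extCoeff_eq i j n with h | ⟨d, rfl, rfl, rfl⟩
  · rw [extCoeff_of_neg _ h, extCoeff_of_neg _ h, mul_zero]
  · rw [extCoeff_natCast, extCoeff_natCast, coeff_euler, Int.cast_natCast]

lemma extCoeff_euler2 (F : MvPowerSeries (Fin 3) ℚ) (i j n : ℤ) :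
    extCoeff (euler 2 F) i j n = n * extCoeff F i j n := by
  rcases exists_extCoeff_eq i j n with h | ⟨d, rfl, rfl, rfl⟩
  · rw [extCoeff_of_neg _ h, extCoeff_of_neg _ h, mul_zero]
  · rw [extCoeff_natCast, extCoeff_natCast, coeff_euler, Int.cast_natCast]

lemma pderiv_mem_ratSpan_of_euler {S : Set (MvPowerSeries (Fin 3) ℚ)} {s : Fin 3}
    {F : MvPowerSeries (Fin 3) ℚ} (h : euler s F ∈ ratSpan S) :
    MvPowerSeries.pderiv ℚ s F ∈ ratSpan S :=
  mem_ratSpan_of_smul_mem (MvPolynomial.X_ne_zero s) h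

/-- A series with finitely many nonzero coefficients is a rational multiple of `1`. -/
lemma mem_ratSpan_of_extCoeff_eq_zero {S : Set (MvPowerSeries (Fin 3) ℚ)} (h1 : 1 ∈ S)
    {R : MvPowerSeries (Fin 3) ℚ} (N : ℕ)
    (hR : ∀ i j n : ℤ, 0 ≤ i → 0 ≤ j → 0 ≤ n → (N < i ∨ N < j ∨ N < n) → extCoeff R i j n = 0) :
    R ∈ ratSpan S := by
  have h : R = MvPowerSeries.trunc' ℚ (Finsupp.equivFunOnFinite.symm fun _ => N) R •
      (1 : MvPowerSeries (Fin 3) ℚ) := by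
    ext d
    rw [MvPowerSeries.polynomial_smul, mul_one, MvPolynomial.coeff_coe, MvPowerSeries.coeff_trunc']
    split_ifs with hd
    · rfl
    · rw [← extCoeff_natCast]
      refine hR _ _ _ (by omega) (by omega) (by omega) ?_
      by_contra! hc
      refine hd fun k => ?_
      fin_cases k <;> simp <;> omega
  rw [h]
  exact Submodule.smul_mem _ _ (subset_ratSpan h1)

/-! ### The boundary series -/

lemma gbCount_of_lt {n : ℕ} {i j : ℤ} (h : n < i ∨ n < j) : gbCount n i j = 0 := by
  by_cases hij : i < 0 ∨ j < 0
  · exact gbCount_of_neg _ _ _ hij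
  obtain ⟨m, hm⟩ := Int.even_or_odd' (n - i)
  rcases hm with hm | hm
  · rw [gbCount_eq_gbClosed (m := m) (by omega) (by omega) (by omega), gbClosed,
      rfact_of_neg (k := m - j) (by omega)]
    simp
  · exact gbCount_eq_zero_of_odd (m := m) (by omega)

/-- The number `q(i, j; n)`, for arbitrary integers `i, j, n`. -/
noncomputable def gbInt (n i j : ℤ) : ℚ := if 0 ≤ n then gbCount n.toNat i j else 0

lemma gbInt_natCast (n : ℕ) (i j : ℤ) : gbInt n i j = gbCount n i j := by simp [gbInt]

lemma gbInt_of_neg {n i j : ℤ} (h : n < 0 ∨ i < 0 ∨ j < 0) : gbInt n i j = 0 := by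
  rw [gbInt]
  split_ifs with hn
  · exact gbCount_of_neg _ _ _ (by omega)
  · rfl

lemma gbInt_of_lt {n i j : ℤ} (h : n < i ∨ n < j) : gbInt n i j = 0 := by
  rw [gbInt]
  split_ifs with hn
  · exact gbCount_of_lt (by omega)
  · rfl

lemma gbInt_of_odd {n i j : ℤ} (h : (n - i) % 2 = 1) : gbInt n i j = 0 := by
  rw [gbInt]
  split_ifs with hn
  · exact gbCount_eq_zero_of_odd (m := (n - i) / 2) (by omega)
  · rfl

lemma extCoeff_eq_of_coeff {F : MvPowerSeries (Fin 3) ℚ} {f : ℤ → ℤ → ℤ → ℚ}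
    (h : ∀ d : Fin 3 →₀ ℕ, F d = f (d 0) (d 1) (d 2))
    (h' : ∀ i j n, i < 0 ∨ j < 0 ∨ n < 0 → f i j n = 0) (i j n : ℤ) :
    extCoeff F i j n = f i j n := by
  rcases exists_extCoeff_eq i j n with hn | ⟨d, rfl, rfl, rfl⟩
  · rw [extCoeff_of_neg _ hn, h' _ _ _ hn]
  · rw [extCoeff_natCast, ← h]
    rfl

/-- The series `Q(x, 0; t)`. -/
noncomputable def gbRow : MvPowerSeries (Fin 3) ℚ :=
  fun d => if (d 1 : ℤ) = 0 then gbInt (d 2) (d 0) 0 else 0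

/-- The series `Q(0, y; t)`. -/
noncomputable def gbColumn : MvPowerSeries (Fin 3) ℚ :=
  fun d => if (d 0 : ℤ) = 0 then gbInt (d 2) 0 (d 1) else 0

/-- The series `Q(0, 0; t)`, in three variables. -/
noncomputable def gbOrigin : MvPowerSeries (Fin 3) ℚ :=
  fun d => if (d 0 : ℤ) = 0 ∧ (d 1 : ℤ) = 0 then gbInt (d 2) (d 0) (d 1) else 0

lemma extCoeff_gbRow (i j n : ℤ) : extCoeff gbRow i j n = if j = 0 then gbInt n i 0 else 0 := by
  refine extCoeff_eq_of_coeff (f := fun i j n => if j = 0 then gbInt n i 0 else 0)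
    (fun d => rfl) (fun i j n h => ?_) i j n
  simp only [ite_eq_right_iff]
  exact fun hj => gbInt_of_neg (by omega)

lemma extCoeff_gbColumn (i j n : ℤ) :
    extCoeff gbColumn i j n = if i = 0 then gbInt n 0 j else 0 := by
  refine extCoeff_eq_of_coeff (f := fun i j n => if i = 0 then gbInt n 0 j else 0)
    (fun d => rfl) (fun i j n h => ?_) i j n
  simp only [ite_eq_right_iff]
  exact fun hj => gbInt_of_neg (by omega)

lemma extCoeff_gbOrigin (i j n : ℤ) :
    extCoeff gbOrigin i j n = if i = 0 ∧ j = 0 then gbInt n i j else 0 := by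
  refine extCoeff_eq_of_coeff (f := fun i j n => if i = 0 ∧ j = 0 then gbInt n i j else 0)
    (fun d => rfl) (fun i j n h => ?_) i j n
  simp only [ite_eq_right_iff]
  exact fun hj => gbInt_of_neg (by omega)

lemma extCoeff_quadrantSeries (i j n : ℤ) :
    extCoeff (quadrantSeries gbSteps) i j n = gbInt n i j := by
  refine extCoeff_eq_of_coeff (f := fun i j n => gbInt n i j)
    (fun d => ?_) (fun i j n h => gbInt_of_neg (by omega)) i j n
  rw [gbInt_natCast, gbCount_natCast]
  rfl

lemma gbInt_succ {n i j : ℤ} (hi : 0 ≤ i) (hj : 0 ≤ j) (hn : 1 ≤ n) :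
    gbInt n i j = gbInt (n - 1) (i - 1) j + gbInt (n - 1) (i + 1) j +
      gbInt (n - 1) (i + 1) (j - 1) + gbInt (n - 1) (i - 1) (j + 1) := by
  obtain ⟨N, rfl⟩ : ∃ N : ℕ, n = (N + 1 : ℕ) := ⟨(n - 1).toNat, by omega⟩
  rw [show ((N + 1 : ℕ) : ℤ) - 1 = N by simp]
  simp only [gbInt_natCast]
  exact gbCount_succ N i j hi hj

/-- The functional equation for `Q(x, y; t)`. -/
lemma gb_functional_equation :
    (tmon 1 1 1 0 - (tmon 1 2 1 1 + tmon 1 0 1 1 + tmon 1 2 0 1 + tmon 1 0 2 1)) •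
        quadrantSeries gbSteps =
      tmon 1 1 1 0 • 1 - (tmon 1 0 1 1 + tmon 1 0 2 1) • gbColumn - tmon 1 2 0 1 • gbRow := by
  -- After multiplication by `xy`, the coefficient at `(i, j)` is the recurrence at `(i - 1, j -
  -- 1)`. The subtracted terms remove W and NW steps from the column `i = 0` and SE steps from the
  -- row `j = 0`.
  refine ext_of_extCoeff fun i j n hi hj hn => ?_
  have h1 : ∀ i j n : ℤ, extCoeff 1 i j n = if i = 0 ∧ j = 0 ∧ n = 0 then 1 else 0 := by
    refine extCoeff_eq_of_coeff (f := fun i j n => if i = 0 ∧ j = 0 ∧ n = 0 then 1 else 0)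
      (fun d => ?_) (fun i j n h => if_neg (by omega))
    change MvPowerSeries.coeff d 1 = _
    classical
    rw [MvPowerSeries.coeff_one]
    refine if_congr ?_ rfl rfl
    simp [Finsupp.ext_iff, Fin.forall_fin_succ]
  simp only [sub_smul, add_smul, extCoeff_sub, extCoeff_add, extCoeff_tmon_smul,
    extCoeff_quadrantSeries, extCoeff_gbColumn, extCoeff_gbRow, h1, Nat.cast_zero, Nat.cast_one,
    Nat.cast_ofNat, sub_zero, one_mul]
  rcases hi.eq_or_lt with rfl | hi
  · simp (disch := omega) only [gbInt_of_neg, if_neg]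
    simp
  rcases hj.eq_or_lt with rfl | hj
  · simp (disch := omega) only [gbInt_of_neg, if_neg]
    simp
  rcases hn.eq_or_lt with rfl | hn
  · have h0 : gbInt 0 (i - 1) (j - 1) = if i - 1 = 0 ∧ j - 1 = 0 then 1 else 0 := by
      rw [← gbCount_zero]
      exact gbInt_natCast 0 _ _
    simp (disch := omega) only [gbInt_of_neg, if_neg, h0]
    simp
  rw [gbInt_succ (i := i - 1) (j := j - 1) (by omega) (by omega) (by omega)]
  simp (disch := omega) only [if_neg]
  ring_nf

/-! ### Hypergeometric expressions for the boundary coefficients -/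

/-- The descending product `x (x - 1) ⋯ (x - k + 1)`. -/
def descProd (x : ℚ) (k : ℕ) : ℚ := ∏ l ∈ Finset.range k, (x - l)

/-- The ascending product `(x + 1) ⋯ (x + k)`. -/
def ascProd (x : ℚ) (k : ℕ) : ℚ := ∏ l ∈ Finset.range k, (x + l + 1)

lemma rfact_sub (x : ℤ) (k : ℕ) : rfact (x - k) = descProd x k * rfact x := by
  induction k with
  | zero => simp [descProd]
  | succ k ih =>
    rw [show x - ((k + 1 : ℕ) : ℤ) = x - k - 1 by push_cast; ring, rfact_sub_one, ih, descProd,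
      descProd, Finset.prod_range_succ]
    push_cast
    ring

lemma factorial_add (N k : ℕ) : ((N + k)! : ℚ) = ascProd N k * N ! := by
  induction k with
  | zero => simp [ascProd]
  | succ k ih =>
    rw [← add_assoc, Nat.factorial_succ, ascProd, Finset.prod_range_succ, ← ascProd]
    push_cast
    rw [ih]
    ring

lemma gbInt_eq_gbClosed {N : ℕ} {n i j m : ℤ} (hN : n = N) (h : n = 2 * m + i) (hi : -1 ≤ i)
    (hj : -1 ≤ j) : gbInt n i j = gbClosed N i j m := by
  rw [hN, gbInt_natCast, gbCount_eq_gbClosed (m := m) hi hj (by omega)]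

/-- Puts all shifted terms of a recurrence over one hypergeometric base in `N, M, R`; `k, s, u`
record how far a term is from the base. The factors `(i + 1)(i + 2)(i + 3)` make the formula valid
slightly outside the quadrant, down to `i = -3`. -/
lemma gbInt_row (N k : ℕ) (M R : ℤ) (n i : ℤ) (s u : ℕ) (hn : n = N + k)
    (hn' : n = M + R - s - u - 4) (hi' : i = R - M + s - u - 2) (hi : -3 ≤ i) :
    gbInt n i 0 = ((i + 1) * (i + 2) * (i + 3) * ascProd N k * ascProd (N + 2) k *
      (descProd M s * descProd M (s + 1) * descProd R u * descProd R (u + 1))) *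
      (N ! * (N + 2)! * rfact M ^ 2 * rfact R ^ 2) := by
  by_cases h : i = -3 ∨ i = -2
  · rw [gbInt_of_neg (by omega)]
    rcases h with rfl | rfl <;> norm_num
  rw [gbInt_eq_gbClosed (N := N + k) (m := M - 1 - s) (by push_cast; omega) (by omega) (by omega)
    (by omega), gbClosed, show M - 1 - s - 0 = M - (s + 1 : ℕ) by push_cast; ring,
    show M - 1 - s + i + 0 + 3 = R - u by omega, show M - 1 - s + 1 = M - s by ring,
    show M - 1 - s + i + 2 = R - (u + 1 : ℕ) by push_cast; omega, rfact_sub, rfact_sub, rfact_sub,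
    rfact_sub, factorial_add, show N + k + 2 = N + 2 + k by ring, factorial_add]
  push_cast
  ring

/-- The analogue of `gbInt_row` on `i = 0`. The factors are `(j + 1)(j + 2)(2j + 3)`, so the formula
reaches only down to `j = -2`. -/
lemma gbInt_column (N k : ℕ) (P R T : ℤ) (n j : ℤ) (s u v : ℕ) (hn : n = N + k)
    (hn' : n = P + R - s - u - 3) (hj' : 2 * j = R - P + s - u - 3) (hT : n = 2 * (T - v - 2))
    (hj : -2 ≤ j) :
    gbInt n 0 j = ((j + 1) * (j + 2) * (2 * j + 3) * ascProd N k * ascProd (N + 2) k *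
      (descProd P s * descProd R u * descProd T v * descProd T (v + 1))) *
      (N ! * (N + 2)! * rfact P * rfact R * rfact T ^ 2) := by
  by_cases h : j = -2
  · rw [gbInt_of_neg (by omega), h]
    norm_num
  rw [gbInt_eq_gbClosed (N := N + k) (m := T - v - 2) (by push_cast; omega) (by omega) (by omega)
    (by omega), gbClosed, show T - v - 2 - j = P - s by omega,
    show T - v - 2 + 0 + j + 3 = R - u by omega, show T - v - 2 + 1 = T - (v + 1 : ℕ) by
      push_cast; ring,
    show T - v - 2 + 0 + 2 = T - v by omega, rfact_sub, rfact_sub, rfact_sub,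
    rfact_sub, factorial_add, show N + k + 2 = N + 2 + k by ring, factorial_add]
  push_cast
  ring

/-! ### First-order differential equations for the boundary series -/

/-- A first-order equation for `Q(x, 0; t)`, in `x` and `t`. -/
lemma gbRow_relation {S : Set (MvPowerSeries (Fin 3) ℚ)} (h1 : 1 ∈ S)
    (hF : gbRow ∈ S) (hO : gbOrigin ∈ S) (hO' : euler 2 gbOrigin ∈ S) :
    (tmon (-1) 0 0 1 + tmon 1 1 0 0 + tmon (-1) 3 0 0 + tmon 1 4 0 1) • euler 0 gbRow +
    (tmon (-1) 0 0 1 + tmon 1 1 0 0 + tmon (-6) 2 0 1 + tmon 1 3 0 0 + tmon (-1) 4 0 1) • euler 2 gbRow ∈ ratSpan S := by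
  have key : ((tmon (-1) 0 0 1 + tmon 1 1 0 0 + tmon (-1) 3 0 0 + tmon 1 4 0 1) • euler 0 gbRow +
    (tmon (-1) 0 0 1 + tmon 1 1 0 0 + tmon (-6) 2 0 1 + tmon 1 3 0 0 + tmon (-1) 4 0 1) • euler 2 gbRow) +
    ((tmon (-6) 0 0 1 + tmon 6 1 0 0 + tmon (-8) 2 0 1 + tmon 2 3 0 0 + tmon (-2) 4 0 1) • gbRow +
    (tmon 6 0 0 1) • gbOrigin +
    (tmon 1 0 0 1) • euler 2 gbOrigin) ∈ ratSpan S := by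
    refine mem_ratSpan_of_extCoeff_eq_zero h1 20 fun i j n hi hj hn hlarge => ?_
    simp only [add_smul, extCoeff_add, extCoeff_tmon_smul, extCoeff_euler0,
      extCoeff_euler2, extCoeff_gbRow, extCoeff_gbOrigin, Nat.cast_zero, Nat.cast_one,
      Nat.cast_ofNat, sub_zero]
    rcases eq_or_ne j 0 with rfl | h0
    swap; · simp [h0]
    simp only [if_true, and_true]
    -- For small `n` the bound `20` forces `i` to be large, and no walk travels further than its
    -- length. Finitely many remaining coefficients are absorbed by the generator `1`.
    rcases lt_or_ge n 1 with hn3 | hn3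
    · simp (disch := omega) only [gbInt_of_lt, if_neg]
      simp
    obtain ⟨h, hh⟩ := Int.even_or_odd' (n - i)
    rcases hh with hh | hh
    · simp (disch := omega) only [gbInt_of_odd]
      simp
    obtain ⟨N, hN⟩ : ∃ N : ℕ, n = N + 1 := ⟨(n - 1).toNat, by omega⟩
    obtain ⟨M, hM⟩ : ∃ M, M = h + 3 := ⟨_, rfl⟩
    obtain ⟨R, hR⟩ : ∃ R, R = h + i + 3 := ⟨_, rfl⟩
    have t01 := gbInt_row N 0 M R (n - 1) (i) 2 0 (by omega) (by omega) (by omega)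
    have t10 := gbInt_row N 1 M R (n) (i - 1) 1 0 (by omega) (by omega) (by omega)
    have t21 := gbInt_row N 0 M R (n - 1) (i - 2) 1 1 (by omega) (by omega) (by omega)
    have t30 := gbInt_row N 1 M R (n) (i - 3) 0 1 (by omega) (by omega) (by omega)
    have t41 := gbInt_row N 0 M R (n - 1) (i - 4) 0 2 (by omega) (by omega) (by omega)
    have hMq : ((M : ℤ) : ℚ) = h + 3 := by exact_mod_cast hM
    have hRq : ((R : ℤ) : ℚ) = h + i + 3 := by exact_mod_cast hR
    have hNq : (N : ℚ) = 2 * h + i + 1 - 1 := by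
      have : (N : ℤ) = 2 * h + i + 1 - 1 := by omega
      exact_mod_cast this
    have hnq : (n : ℚ) = 2 * h + i + 1 := by
      have : n = 2 * h + i + 1 := by omega
      exact_mod_cast this
    -- At `i = 0` the term with index `i - 4 = -4` is zero although the formula of `gbInt_row` is
    -- not; the `gbOrigin` terms, present only there, compensate.
    rcases (show i = 0 ∨ 1 ≤ i by omega) with hk | hk
    · rw [t01 (by omega), t10 (by omega), t21 (by omega), t30 (by omega), gbInt_of_neg (n := n
        - 1) (i := i - 4) (j := 0) (by omega)]
      simp (disch := omega) only [if_pos]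
      generalize (N ! : ℚ) * (N + 2)! * rfact M ^ 2 * rfact R ^ 2 = b
      simp only [ascProd, descProd, Finset.prod_range_succ, Finset.prod_range_zero]
      push_cast
      have hkq : (i : ℚ) = 0 := by exact_mod_cast hk
      simp only [hMq, hRq, hNq, hnq, hkq]
      ring
    · rw [t01 (by omega), t10 (by omega), t21 (by omega), t30 (by omega), t41 (by omega)]
      simp (disch := omega) only [if_neg]
      generalize (N ! : ℚ) * (N + 2)! * rfact M ^ 2 * rfact R ^ 2 = b
      simp only [ascProd, descProd, Finset.prod_range_succ, Finset.prod_range_zero]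
      push_cast
      simp only [hMq, hRq, hNq, hnq]
      ring
  refine (Submodule.add_mem_iff_left _ ?_).mp key
  exact add_mem (add_mem (Submodule.smul_mem _ _ (subset_ratSpan hF)) (Submodule.smul_mem _ _ (subset_ratSpan hO))) (Submodule.smul_mem _ _ (subset_ratSpan hO'))

/-- A first-order equation for `Q(x, 0; t)`, in `t` only. -/
lemma gbRow_relation_time {S : Set (MvPowerSeries (Fin 3) ℚ)} (h1 : 1 ∈ S)
    (hF : gbRow ∈ S) (hO : gbOrigin ∈ S) (hO' : euler 2 gbOrigin ∈ S) :
    (tmon (-2) 0 0 3 + tmon 5 1 0 2 + tmon (-4) 2 0 1 + tmon 2 2 0 3 + tmon 1 3 0 0 + tmon 6 3 0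
    2 + tmon (-4) 4 0 1 + tmon 2 4 0 3 + tmon 5 5 0 2 + tmon (-2) 6 0 3) • euler 2 gbRow ∈ ratSpan S := by
  have key : ((tmon (-2) 0 0 3 + tmon 5 1 0 2 + tmon (-4) 2 0 1 + tmon 2 2 0 3 + tmon 1 3 0 0 + tmon 6 3 0
    2 + tmon (-4) 4 0 1 + tmon 2 4 0 3 + tmon 5 5 0 2 + tmon (-2) 6 0 3) • euler 2 gbRow) +
    ((tmon (-2) 0 0 3 + tmon 8 1 0 2 + tmon (-9) 2 0 1 + tmon 2 2 0 3 + tmon 3 3 0 0 + tmon 8 3 0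
    2 + tmon (-9) 4 0 1 + tmon 2 4 0 3 + tmon 8 5 0 2 + tmon (-2) 6 0 3) • gbRow +
    (tmon 2 0 0 3 + tmon (-8) 1 0 2 + tmon 2 2 0 3) • gbOrigin +
    (tmon 2 0 0 3 + tmon (-3) 1 0 2 + tmon 2 2 0 3) • euler 2 gbOrigin) ∈ ratSpan S := by
    refine mem_ratSpan_of_extCoeff_eq_zero h1 20 fun i j n hi hj hn hlarge => ?_
    simp only [add_smul, extCoeff_add, extCoeff_tmon_smul, 
      extCoeff_euler2, extCoeff_gbRow, extCoeff_gbOrigin, Nat.cast_zero, Nat.cast_one,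
      Nat.cast_ofNat, sub_zero]
    rcases eq_or_ne j 0 with rfl | h0
    swap; · simp [h0]
    simp only [if_true, and_true]
    rcases lt_or_ge n 3 with hn3 | hn3
    · simp (disch := omega) only [gbInt_of_lt, if_neg]
      simp
    obtain ⟨h, hh⟩ := Int.even_or_odd' (n - i)
    rcases hh with hh | hh
    · simp (disch := omega) only [gbInt_of_odd]
      simp
    obtain ⟨N, hN⟩ : ∃ N : ℕ, n = N + 3 := ⟨(n - 3).toNat, by omega⟩
    obtain ⟨M, hM⟩ : ∃ M, M = h + 3 := ⟨_, rfl⟩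
    obtain ⟨R, hR⟩ : ∃ R, R = h + i + 2 := ⟨_, rfl⟩
    have t03 := gbInt_row N 0 M R (n - 3) (i) 3 0 (by omega) (by omega) (by omega)
    have t12 := gbInt_row N 1 M R (n - 2) (i - 1) 2 0 (by omega) (by omega) (by omega)
    have t21 := gbInt_row N 2 M R (n - 1) (i - 2) 1 0 (by omega) (by omega) (by omega)
    have t23 := gbInt_row N 0 M R (n - 3) (i - 2) 2 1 (by omega) (by omega) (by omega)
    have t30 := gbInt_row N 3 M R (n) (i - 3) 0 0 (by omega) (by omega) (by omega)
    have t32 := gbInt_row N 1 M R (n - 2) (i - 3) 1 1 (by omega) (by omega) (by omega)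
    have t41 := gbInt_row N 2 M R (n - 1) (i - 4) 0 1 (by omega) (by omega) (by omega)
    have t43 := gbInt_row N 0 M R (n - 3) (i - 4) 1 2 (by omega) (by omega) (by omega)
    have t52 := gbInt_row N 1 M R (n - 2) (i - 5) 0 2 (by omega) (by omega) (by omega)
    have t63 := gbInt_row N 0 M R (n - 3) (i - 6) 0 3 (by omega) (by omega) (by omega)
    have hMq : ((M : ℤ) : ℚ) = h + 3 := by exact_mod_cast hM
    have hRq : ((R : ℤ) : ℚ) = h + i + 2 := by exact_mod_cast hR
    have hNq : (N : ℚ) = 2 * h + i + 1 - 3 := by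
      have : (N : ℤ) = 2 * h + i + 1 - 3 := by omega
      exact_mod_cast this
    have hnq : (n : ℚ) = 2 * h + i + 1 := by
      have : n = 2 * h + i + 1 := by omega
      exact_mod_cast this
    -- Shifts reach `i - 6`, so `i = 0, 1, 2` leave the range `-3 ≤ i` of `gbInt_row`; these are the
    -- powers of `x` multiplying `gbOrigin`.
    rcases (show i = 0 ∨ i = 1 ∨ i = 2 ∨ 3 ≤ i by omega) with hk | hk | hk | hk
    · rw [t03 (by omega), t12 (by omega), t21 (by omega), t23 (by omega), t30 (by omega), t32
        (by omega), gbInt_of_neg (n := n - 1) (i := i - 4) (j := 0) (by omega), gbInt_of_neg (n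
        := n - 3) (i := i - 4) (j := 0) (by omega), gbInt_of_neg (n := n - 2) (i := i - 5) (j :=
        0) (by omega), gbInt_of_neg (n := n - 3) (i := i - 6) (j := 0) (by omega)]
      simp (disch := omega) only [if_neg, if_pos]
      generalize (N ! : ℚ) * (N + 2)! * rfact M ^ 2 * rfact R ^ 2 = b
      simp only [ascProd, descProd, Finset.prod_range_succ, Finset.prod_range_zero]
      push_cast
      have hkq : (i : ℚ) = 0 := by exact_mod_cast hk
      simp only [hMq, hRq, hNq, hnq, hkq]
      ring
    · rw [t03 (by omega), t12 (by omega), t21 (by omega), t23 (by omega), t30 (by omega), t32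
        (by omega), t41 (by omega), t43 (by omega), gbInt_of_neg (n := n - 2) (i := i - 5) (j :=
        0) (by omega), gbInt_of_neg (n := n - 3) (i := i - 6) (j := 0) (by omega)]
      simp (disch := omega) only [if_neg, if_pos]
      generalize (N ! : ℚ) * (N + 2)! * rfact M ^ 2 * rfact R ^ 2 = b
      simp only [ascProd, descProd, Finset.prod_range_succ, Finset.prod_range_zero]
      push_cast
      have hkq : (i : ℚ) = 1 := by exact_mod_cast hk
      simp only [hMq, hRq, hNq, hnq, hkq]
      ring
    · rw [t03 (by omega), t12 (by omega), t21 (by omega), t23 (by omega), t30 (by omega), t32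
        (by omega), t41 (by omega), t43 (by omega), t52 (by omega), gbInt_of_neg (n := n - 3) (i
        := i - 6) (j := 0) (by omega)]
      simp (disch := omega) only [if_neg, if_pos]
      generalize (N ! : ℚ) * (N + 2)! * rfact M ^ 2 * rfact R ^ 2 = b
      simp only [ascProd, descProd, Finset.prod_range_succ, Finset.prod_range_zero]
      push_cast
      have hkq : (i : ℚ) = 2 := by exact_mod_cast hk
      simp only [hMq, hRq, hNq, hnq, hkq]
      ring
    · rw [t03 (by omega), t12 (by omega), t21 (by omega), t23 (by omega), t30 (by omega), t32
        (by omega), t41 (by omega), t43 (by omega), t52 (by omega), t63 (by omega)]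
      simp (disch := omega) only [if_neg]
      generalize (N ! : ℚ) * (N + 2)! * rfact M ^ 2 * rfact R ^ 2 = b
      simp only [ascProd, descProd, Finset.prod_range_succ, Finset.prod_range_zero]
      push_cast
      simp only [hMq, hRq, hNq, hnq]
      ring
  refine (Submodule.add_mem_iff_left _ ?_).mp key
  exact add_mem (add_mem (Submodule.smul_mem _ _ (subset_ratSpan hF)) (Submodule.smul_mem _ _ (subset_ratSpan hO))) (Submodule.smul_mem _ _ (subset_ratSpan hO'))

/-- A first-order equation for `Q(0, y; t)`. -/
lemma gbColumn_relation {S : Set (MvPowerSeries (Fin 3) ℚ)} (h1 : 1 ∈ S)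
    (hF : gbColumn ∈ S) (hO : gbOrigin ∈ S) :
    (tmon (-4) 0 0 2 + tmon (-1) 0 1 0 + tmon (-8) 0 1 2 + tmon 1 0 3 0 + tmon 8 0 3 2 + tmon 4
    0 4 2) • euler 1 gbColumn +
    (tmon (-1) 0 1 0 + tmon 16 0 1 2 + tmon (-2) 0 2 0 + tmon 32 0 2 2 + tmon (-1) 0 3 0 + tmon
    16 0 3 2) • euler 2 gbColumn ∈ ratSpan S := by
  have key : ((tmon (-4) 0 0 2 + tmon (-1) 0 1 0 + tmon (-8) 0 1 2 + tmon 1 0 3 0 + tmon 8 0 3 2 + tmon 4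
    0 4 2) • euler 1 gbColumn +
    (tmon (-1) 0 1 0 + tmon 16 0 1 2 + tmon (-2) 0 2 0 + tmon 32 0 2 2 + tmon (-1) 0 3 0 + tmon
    16 0 3 2) • euler 2 gbColumn) +
    ((tmon (-10) 0 0 2 + tmon (-4) 0 1 0 + tmon (-4) 0 1 2 + tmon (-13) 0 2 0 + tmon 24 0 2 2 +
    tmon (-1) 0 3 0 + tmon 20 0 3 2 + tmon 2 0 4 2) • gbColumn +
    (tmon 10 0 0 2 + tmon 10 0 1 2) • gbOrigin) ∈ ratSpan S := by
    refine mem_ratSpan_of_extCoeff_eq_zero h1 20 fun i j n hi hj hn hlarge => ?_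
    simp only [add_smul, extCoeff_add, extCoeff_tmon_smul, extCoeff_euler1,
      extCoeff_euler2, extCoeff_gbColumn, extCoeff_gbOrigin, Nat.cast_zero, Nat.cast_one,
      Nat.cast_ofNat, sub_zero]
    rcases eq_or_ne i 0 with rfl | h0
    swap; · simp [h0]
    simp only [if_true, true_and]
    rcases lt_or_ge n 2 with hn3 | hn3
    · simp (disch := omega) only [gbInt_of_lt, if_neg]
      simp
    obtain ⟨h, hh⟩ := Int.even_or_odd' (n)
    rcases hh with hh | hh
    swap
    · simp (disch := omega) only [gbInt_of_odd]
      simp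
    obtain ⟨N, hN⟩ : ∃ N : ℕ, n = N + 2 := ⟨(n - 2).toNat, by omega⟩
    obtain ⟨P, hP⟩ : ∃ P, P = h - j + 3 := ⟨_, rfl⟩
    obtain ⟨R, hR⟩ : ∃ R, R = h + j + 2 := ⟨_, rfl⟩
    obtain ⟨T, hT⟩ : ∃ T, T = h + 2 := ⟨_, rfl⟩
    have t02 := gbInt_column N 0 P R T (n - 2) (j) 4 0 1 (by omega) (by omega)
      (by omega) (by omega)
    have t10 := gbInt_column N 2 P R T (n) (j - 1) 2 0 0 (by omega) (by omega)
      (by omega) (by omega)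
    have t12 := gbInt_column N 0 P R T (n - 2) (j - 1) 3 1 1 (by omega) (by omega)
      (by omega) (by omega)
    have t20 := gbInt_column N 2 P R T (n) (j - 2) 1 1 0 (by omega) (by omega)
      (by omega) (by omega)
    have t22 := gbInt_column N 0 P R T (n - 2) (j - 2) 2 2 1 (by omega) (by omega)
      (by omega) (by omega)
    have t30 := gbInt_column N 2 P R T (n) (j - 3) 0 2 0 (by omega) (by omega)
      (by omega) (by omega)
    have t32 := gbInt_column N 0 P R T (n - 2) (j - 3) 1 3 1 (by omega) (by omega)
      (by omega) (by omega)
    have t42 := gbInt_column N 0 P R T (n - 2) (j - 4) 0 4 1 (by omega) (by omega)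
      (by omega) (by omega)
    have hPq : ((P : ℤ) : ℚ) = h - j + 3 := by exact_mod_cast hP
    have hRq : ((R : ℤ) : ℚ) = h + j + 2 := by exact_mod_cast hR
    have hTq : ((T : ℤ) : ℚ) = h + 2 := by exact_mod_cast hT
    have hNq : (N : ℚ) = 2 * h - 2 := by
      have : (N : ℤ) = 2 * h - 2 := by omega
      exact_mod_cast this
    have hnq : (n : ℚ) = 2 * h := by
      have : n = 2 * h := by omega
      exact_mod_cast this
    -- Shifts reach `j - 4`, beyond the range `-2 ≤ j` of `gbInt_column` exactly for `j = 0, 1`.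
    rcases (show j = 0 ∨ j = 1 ∨ 2 ≤ j by omega) with hk | hk | hk
    · rw [t02 (by omega), t10 (by omega), t12 (by omega), t20 (by omega), t22 (by omega),
        gbInt_of_neg (n := n) (j := j - 3) (i := 0) (by omega), gbInt_of_neg (n := n - 2) (j :=
        j - 3) (i := 0) (by omega), gbInt_of_neg (n := n - 2) (j := j - 4) (i := 0) (by omega)]
      simp (disch := omega) only [if_neg, if_pos]
      generalize (N ! : ℚ) * (N + 2)! * rfact P * rfact R * rfact T ^ 2 = b
      simp only [ascProd, descProd, Finset.prod_range_succ, Finset.prod_range_zero]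
      push_cast
      have hkq : (j : ℚ) = 0 := by exact_mod_cast hk
      simp only [hPq, hRq, hTq, hNq, hnq, hkq]
      ring
    · rw [t02 (by omega), t10 (by omega), t12 (by omega), t20 (by omega), t22 (by omega), t30
        (by omega), t32 (by omega), gbInt_of_neg (n := n - 2) (j := j - 4) (i := 0) (by omega)]
      simp (disch := omega) only [if_neg, if_pos]
      generalize (N ! : ℚ) * (N + 2)! * rfact P * rfact R * rfact T ^ 2 = b
      simp only [ascProd, descProd, Finset.prod_range_succ, Finset.prod_range_zero]
      push_cast
      have hkq : (j : ℚ) = 1 := by exact_mod_cast hk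
      simp only [hPq, hRq, hTq, hNq, hnq, hkq]
      ring
    · rw [t02 (by omega), t10 (by omega), t12 (by omega), t20 (by omega), t22 (by omega), t30
        (by omega), t32 (by omega), t42 (by omega)]
      simp (disch := omega) only [if_neg]
      generalize (N ! : ℚ) * (N + 2)! * rfact P * rfact R * rfact T ^ 2 = b
      simp only [ascProd, descProd, Finset.prod_range_succ, Finset.prod_range_zero]
      push_cast
      simp only [hPq, hRq, hTq, hNq, hnq]
      ring
  refine (Submodule.add_mem_iff_left _ ?_).mp key
  exact add_mem (Submodule.smul_mem _ _ (subset_ratSpan hF)) (Submodule.smul_mem _ _ (subset_ratSpan hO))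

/-- A second first-order equation for `Q(0, y; t)`. -/
lemma gbColumn_relation_second {S : Set (MvPowerSeries (Fin 3) ℚ)} (h1 : 1 ∈ S)
    (hF : gbColumn ∈ S) (hO' : euler 2 gbOrigin ∈ S) :
    (tmon 2 0 0 2 + tmon 3 0 1 0 + tmon 4 0 1 2 + tmon (-3) 0 3 0 + tmon (-4) 0 3 2 + tmon (-2)
    0 4 2) • euler 1 gbColumn +
    (tmon (-5) 0 0 2 + tmon 3 0 1 0 + tmon (-28) 0 1 2 + tmon 1 0 2 0 + tmon (-46) 0 2 2 + tmon
    3 0 3 0 + tmon (-28) 0 3 2 + tmon (-5) 0 4 2) • euler 2 gbColumn ∈ ratSpan S := by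
  have key : ((tmon 2 0 0 2 + tmon 3 0 1 0 + tmon 4 0 1 2 + tmon (-3) 0 3 0 + tmon (-4) 0 3 2 + tmon (-2)
    0 4 2) • euler 1 gbColumn +
    (tmon (-5) 0 0 2 + tmon 3 0 1 0 + tmon (-28) 0 1 2 + tmon 1 0 2 0 + tmon (-46) 0 2 2 + tmon
    3 0 3 0 + tmon (-28) 0 3 2 + tmon (-5) 0 4 2) • euler 2 gbColumn) +
    ((tmon 12 0 1 0 + tmon (-18) 0 1 2 + tmon 19 0 2 0 + tmon (-42) 0 2 2 + tmon 3 0 3 0 + tmon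
    (-30) 0 3 2 + tmon (-6) 0 4 2) • gbColumn +
    (tmon 5 0 0 2 + tmon 5 0 1 2) • euler 2 gbOrigin) ∈ ratSpan S := by
    refine mem_ratSpan_of_extCoeff_eq_zero h1 20 fun i j n hi hj hn hlarge => ?_
    simp only [add_smul, extCoeff_add, extCoeff_tmon_smul, extCoeff_euler1,
      extCoeff_euler2, extCoeff_gbColumn, extCoeff_gbOrigin, Nat.cast_zero, Nat.cast_one,
      Nat.cast_ofNat, sub_zero]
    rcases eq_or_ne i 0 with rfl | h0
    swap; · simp [h0]
    simp only [if_true, true_and]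
    rcases lt_or_ge n 2 with hn3 | hn3
    · simp (disch := omega) only [gbInt_of_lt, if_neg]
      simp
    obtain ⟨h, hh⟩ := Int.even_or_odd' (n)
    rcases hh with hh | hh
    swap
    · simp (disch := omega) only [gbInt_of_odd]
      simp
    obtain ⟨N, hN⟩ : ∃ N : ℕ, n = N + 2 := ⟨(n - 2).toNat, by omega⟩
    obtain ⟨P, hP⟩ : ∃ P, P = h - j + 3 := ⟨_, rfl⟩
    obtain ⟨R, hR⟩ : ∃ R, R = h + j + 2 := ⟨_, rfl⟩
    obtain ⟨T, hT⟩ : ∃ T, T = h + 2 := ⟨_, rfl⟩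
    have t02 := gbInt_column N 0 P R T (n - 2) (j) 4 0 1 (by omega) (by omega)
      (by omega) (by omega)
    have t10 := gbInt_column N 2 P R T (n) (j - 1) 2 0 0 (by omega) (by omega)
      (by omega) (by omega)
    have t12 := gbInt_column N 0 P R T (n - 2) (j - 1) 3 1 1 (by omega) (by omega)
      (by omega) (by omega)
    have t20 := gbInt_column N 2 P R T (n) (j - 2) 1 1 0 (by omega) (by omega)
      (by omega) (by omega)
    have t22 := gbInt_column N 0 P R T (n - 2) (j - 2) 2 2 1 (by omega) (by omega)
      (by omega) (by omega)
    have t30 := gbInt_column N 2 P R T (n) (j - 3) 0 2 0 (by omega) (by omega)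
      (by omega) (by omega)
    have t32 := gbInt_column N 0 P R T (n - 2) (j - 3) 1 3 1 (by omega) (by omega)
      (by omega) (by omega)
    have t42 := gbInt_column N 0 P R T (n - 2) (j - 4) 0 4 1 (by omega) (by omega)
      (by omega) (by omega)
    have hPq : ((P : ℤ) : ℚ) = h - j + 3 := by exact_mod_cast hP
    have hRq : ((R : ℤ) : ℚ) = h + j + 2 := by exact_mod_cast hR
    have hTq : ((T : ℤ) : ℚ) = h + 2 := by exact_mod_cast hT
    have hNq : (N : ℚ) = 2 * h - 2 := by
      have : (N : ℤ) = 2 * h - 2 := by omega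
      exact_mod_cast this
    have hnq : (n : ℚ) = 2 * h := by
      have : n = 2 * h := by omega
      exact_mod_cast this
    rcases (show j = 0 ∨ j = 1 ∨ 2 ≤ j by omega) with hk | hk | hk
    · rw [t02 (by omega), t10 (by omega), t12 (by omega), t20 (by omega), t22 (by omega),
        gbInt_of_neg (n := n) (j := j - 3) (i := 0) (by omega), gbInt_of_neg (n := n - 2) (j :=
        j - 3) (i := 0) (by omega), gbInt_of_neg (n := n - 2) (j := j - 4) (i := 0) (by omega)]
      simp (disch := omega) only [if_neg, if_pos]
      generalize (N ! : ℚ) * (N + 2)! * rfact P * rfact R * rfact T ^ 2 = b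
      simp only [ascProd, descProd, Finset.prod_range_succ, Finset.prod_range_zero]
      push_cast
      have hkq : (j : ℚ) = 0 := by exact_mod_cast hk
      simp only [hPq, hRq, hTq, hNq, hnq, hkq]
      ring
    · rw [t02 (by omega), t10 (by omega), t12 (by omega), t20 (by omega), t22 (by omega), t30
        (by omega), t32 (by omega), gbInt_of_neg (n := n - 2) (j := j - 4) (i := 0) (by omega)]
      simp (disch := omega) only [if_neg, if_pos]
      generalize (N ! : ℚ) * (N + 2)! * rfact P * rfact R * rfact T ^ 2 = b
      simp only [ascProd, descProd, Finset.prod_range_succ, Finset.prod_range_zero]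
      push_cast
      have hkq : (j : ℚ) = 1 := by exact_mod_cast hk
      simp only [hPq, hRq, hTq, hNq, hnq, hkq]
      ring
    · rw [t02 (by omega), t10 (by omega), t12 (by omega), t20 (by omega), t22 (by omega), t30
        (by omega), t32 (by omega), t42 (by omega)]
      simp (disch := omega) only [if_neg]
      generalize (N ! : ℚ) * (N + 2)! * rfact P * rfact R * rfact T ^ 2 = b
      simp only [ascProd, descProd, Finset.prod_range_succ, Finset.prod_range_zero]
      push_cast
      simp only [hPq, hRq, hTq, hNq, hnq]
      ring
  refine (Submodule.add_mem_iff_left _ ?_).mp key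
  exact add_mem (Submodule.smul_mem _ _ (subset_ratSpan hF)) (Submodule.smul_mem _ _ (subset_ratSpan hO'))

/-- The second-order differential equation for `Q(0, 0; t)`. -/
lemma gbOrigin_relation {S : Set (MvPowerSeries (Fin 3) ℚ)} (h1 : 1 ∈ S)
    (hO : gbOrigin ∈ S) (hO' : euler 2 gbOrigin ∈ S) :
    (tmon 1 0 0 0 + tmon (-16) 0 0 2) • euler 2 (euler 2 gbOrigin) ∈ ratSpan S := by
  -- On coefficients this is `(n + 4)(n + 6) q(n) = 16 (n - 1)(n + 1) q(n - 2)`, the ratio of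
  -- consecutive excursion numbers.
  have key : (tmon 1 0 0 0 + tmon (-16) 0 0 2) • euler 2 (euler 2 gbOrigin) +
      ((tmon 10 0 0 0 + tmon (-64) 0 0 2) • euler 2 gbOrigin +
        (tmon 24 0 0 0 + tmon (-48) 0 0 2) • gbOrigin) ∈ ratSpan S := by
    refine mem_ratSpan_of_extCoeff_eq_zero h1 2 fun i j n hi hj hn hlarge => ?_
    simp only [add_smul, extCoeff_add, extCoeff_tmon_smul, extCoeff_euler2, extCoeff_gbOrigin,
      Nat.cast_zero, Nat.cast_ofNat, sub_zero]
    by_cases h0 : i = 0 ∧ j = 0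
    swap; · simp [h0]
    obtain ⟨rfl, rfl⟩ := h0
    simp only [and_self, if_true]
    obtain ⟨h, hh⟩ := Int.even_or_odd' n
    rcases hh with hh | hh
    swap
    · simp (disch := omega) only [gbInt_of_odd]
      simp
    obtain ⟨N, hN⟩ : ∃ N : ℕ, n = N + 2 := ⟨(n - 2).toNat, by omega⟩
    obtain ⟨M, hM⟩ : ∃ M, M = h + 1 := ⟨_, rfl⟩
    obtain ⟨R, hR⟩ : ∃ R, R = h + 3 := ⟨_, rfl⟩
    rw [gbInt_row N 2 M R n 0 0 0 (by omega) (by omega) (by omega) (by omega),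
      gbInt_row N 0 M R (n - 2) 0 1 1 (by omega) (by omega) (by omega) (by omega)]
    generalize (N ! : ℚ) * (N + 2)! * rfact M ^ 2 * rfact R ^ 2 = b
    have hMq : (M : ℚ) = h + 1 := by exact_mod_cast hM
    have hRq : (R : ℚ) = h + 3 := by exact_mod_cast hR
    have hNq : (N : ℚ) = 2 * h - 2 := by
      have : (N : ℤ) = 2 * h - 2 := by omega
      exact_mod_cast this
    have hnq : (n : ℚ) = 2 * h := by exact_mod_cast hh
    simp only [ascProd, descProd, Finset.prod_range_succ, Finset.prod_range_zero]
    push_cast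
    simp only [hMq, hRq, hNq, hnq]
    ring
  refine (Submodule.add_mem_iff_left _ ?_).mp key
  exact add_mem (Submodule.smul_mem _ _ (subset_ratSpan hO'))
    (Submodule.smul_mem _ _ (subset_ratSpan hO))

/-! ### D-finiteness of the generating function -/

lemma euler_eq_zero {s : Fin 3} {F : MvPowerSeries (Fin 3) ℚ}
    (h : ∀ d : Fin 3 →₀ ℕ, d s ≠ 0 → MvPowerSeries.coeff d F = 0) : euler s F = 0 := by
  ext d
  rw [coeff_euler, map_zero]
  by_cases hd : d s = 0
  · simp [hd]
  · rw [h d hd, mul_zero]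

/-- The five series that span `Q(x, y; t)` and all its derivatives over `ℚ(x, y, t)`. -/
def gbSpanning : Set (MvPowerSeries (Fin 3) ℚ) :=
  {1, gbOrigin, euler 2 gbOrigin, gbRow, gbColumn}

lemma ne_zero_of_eval_ne_zero {p : MvPolynomial (Fin 3) ℚ} (v : Fin 3 → ℚ)
    (h : MvPolynomial.eval v p ≠ 0) : p ≠ 0 := by
  rintro rfl
  exact h (map_zero _)

/-- Cramer's rule in `ratSpan S`. -/
lemma mem_ratSpan_of_two_relations {S : Set (MvPowerSeries (Fin 3) ℚ)}
    {a b c d : MvPolynomial (Fin 3) ℚ} {F G : MvPowerSeries (Fin 3) ℚ}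
    (h1 : a • F + b • G ∈ ratSpan S) (h2 : c • F + d • G ∈ ratSpan S) (h : a * d - b * c ≠ 0) :
    F ∈ ratSpan S ∧ G ∈ ratSpan S := by
  constructor
  · refine mem_ratSpan_of_smul_mem h ?_
    convert sub_mem (Submodule.smul_mem _ d h1) (Submodule.smul_mem _ b h2) using 1
    module
  · refine mem_ratSpan_of_smul_mem h ?_
    convert sub_mem (Submodule.smul_mem _ a h2) (Submodule.smul_mem _ c h1) using 1
    module

/-- For each boundary series the two first-order equations form a linear system for its two nonzero
Euler derivatives, solved by Cramer's rule. Derivatives in a variable that does not occur are zero.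
-/
lemma euler_gbSpanning_mem {G : MvPowerSeries (Fin 3) ℚ} (hG : G ∈ gbSpanning) (s : Fin 3) :
    euler s G ∈ ratSpan gbSpanning := by
  have m1 : (1 : MvPowerSeries (Fin 3) ℚ) ∈ gbSpanning := by simp [gbSpanning]
  have mO : gbOrigin ∈ gbSpanning := by simp [gbSpanning]
  have mO' : euler 2 gbOrigin ∈ gbSpanning := by simp [gbSpanning]
  have mR : gbRow ∈ gbSpanning := by simp [gbSpanning]
  have mC : gbColumn ∈ gbSpanning := by simp [gbSpanning]
  have zero_mem' : ∀ {s F}, euler s F = 0 → euler s F ∈ ratSpan gbSpanning := by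
    intro s F h
    rw [h]
    exact zero_mem _
  have hrow := mem_ratSpan_of_two_relations (gbRow_relation m1 mR mO mO')
    (by rw [zero_smul, zero_add]; exact gbRow_relation_time m1 mR mO mO')
    -- The determinant is a nonzero polynomial because its value at `x = y = t = 3` is nonzero.
    (ne_zero_of_eval_ne_zero (fun _ => 3) (by
      simp only [map_sub, map_mul, map_add, eval_tmon, map_zero]
      norm_num))
  have hcol := mem_ratSpan_of_two_relations (gbColumn_relation m1 mC mO)
    (gbColumn_relation_second m1 mC mO')
    (ne_zero_of_eval_ne_zero (fun _ => 3) (by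
      simp only [map_sub, map_mul, map_add, eval_tmon]
      norm_num))
  have horigin := mem_ratSpan_of_smul_mem (ne_zero_of_eval_ne_zero (fun _ => 3) (by
      simp only [map_add, eval_tmon]
      norm_num)) (gbOrigin_relation m1 mO mO')
  have hO0 : ∀ s ≠ 2, ∀ d : Fin 3 →₀ ℕ, d s ≠ 0 →
      MvPowerSeries.coeff d gbOrigin = 0 := by
    intro s hs d hd
    refine if_neg ?_
    rintro ⟨h0, h1⟩
    fin_cases s
    · exact hd (by exact_mod_cast h0)
    · exact hd (by exact_mod_cast h1)
    · exact hs rfl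
  have hsplit : s ≠ 2 ∨ s = 2 := ne_or_eq s 2
  rcases hG with rfl | rfl | rfl | rfl | rfl
  · refine zero_mem' ?_
    rw [euler, MvPowerSeries.pderiv_one, smul_zero]
  · rcases hsplit with hs | rfl
    · exact zero_mem' (euler_eq_zero (hO0 s hs))
    · exact subset_ratSpan mO'
  · rcases hsplit with hs | rfl
    · refine zero_mem' (euler_eq_zero fun d hd => ?_)
      rw [coeff_euler, hO0 s hs d hd, mul_zero]
    · exact horigin
  · fin_cases s
    · exact hrow.1
    · refine zero_mem' (euler_eq_zero fun d hd => if_neg ?_)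
      exact_mod_cast hd
    · exact hrow.2
  · fin_cases s
    · refine zero_mem' (euler_eq_zero fun d hd => if_neg ?_)
      exact_mod_cast hd
    · exact hcol.1
    · exact hcol.2

theorem isDFinite_quadrantSeries_gbSteps : IsDFinite (quadrantSeries gbSteps) := by
  refine isDFinite_of_mem_ratSpan (S := gbSpanning) (by simp [gbSpanning])
    (fun G hG s => pderiv_mem_ratSpan_of_euler (euler_gbSpanning_mem hG s)) ?_
  have h : (tmon 1 1 1 0 - (tmon 1 2 1 1 + tmon 1 0 1 1 + tmon 1 2 0 1 + tmon 1 0 2 1)) •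
      quadrantSeries gbSteps ∈ ratSpan gbSpanning := by
    rw [gb_functional_equation]
    exact sub_mem (sub_mem
      (Submodule.smul_mem _ _ (subset_ratSpan (by simp [gbSpanning])))
      (Submodule.smul_mem _ _ (subset_ratSpan (by simp [gbSpanning]))))
      (Submodule.smul_mem _ _ (subset_ratSpan (by simp [gbSpanning])))
  -- Divide by the kernel `xy (1 - t (x + x⁻¹ + xy⁻¹ + x⁻¹y))`, a nonzero polynomial.
  refine mem_ratSpan_of_smul_mem ?_ h
  refine ne_zero_of_eval_ne_zero (fun _ => 3) ?_
  simp only [map_sub, map_add, eval_tmon]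
  norm_num

theorem mainTheorem4 :
    -- `Q(x, y; t)` is the non-negative part of the rational function
    quadrantSeries gbSteps = nonnegPart gbRational ∧
    -- `Q(x, y; t)` is D-finite
    IsDFinite (quadrantSeries gbSteps) ∧
    -- the number of walks of length `n = 2m + i` ending at `(i, j)`
    (∀ (i j n : ℕ) (m : ℤ), (n : ℤ) = 2 * m + i →
      (quadrantWalks gbSteps i j n : ℚ) =
        ((i + 1) * (j + 1) * (i + j + 2) * (i + 2 * j + 3)) /
            ((2 * m + i + 1) * (2 * m + i + 2) * (2 * m + i + 3) ^ 2) *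
          intChoose (n + 3) (m - j) * intChoose (n + 3) (m + 1)) ∧
    -- the number of walks of length `2m` ending at `(0, 0)`, and its asymptotic behaviour
    (∀ m : ℕ, (quadrantWalks gbSteps 0 0 (2 * m) : ℚ) =
      (6 * (2 * m)! * (2 * m + 2)! : ℕ) / (m ! * (m + 1)! * (m + 2)! * (m + 3)! : ℕ)) ∧
    (fun m : ℕ => (quadrantWalks gbSteps 0 0 (2 * m) : ℝ)) ~[Filter.atTop]
      (fun m : ℕ => 24 * 4 ^ (2 * m) / (Real.pi * (m : ℝ) ^ 5)) ∧
    -- `Q(0, 0; t)` and `Q(x, y; t)` are transcendental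
    Transcendental (Polynomial ℚ) (specializeZeroZero (quadrantSeries gbSteps)) ∧
    Transcendental (MvPolynomial (Fin 3) ℚ) (quadrantSeries gbSteps) :=
  ⟨quadrantSeries_gbSteps_eq_nonnegPart, isDFinite_quadrantSeries_gbSteps,
    quadrantWalks_gbSteps_eq, quadrantWalks_gbSteps_origin, quadrantWalks_origin_isEquivalent,
    transcendental_specializeZeroZero,
    transcendental_of_specializeZeroZero transcendental_specializeZeroZero⟩
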